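/- **Setting.** A surface code on $n$ qubits is given by check matrices $H_Z\in\mathbb F_2^{r\times n}$, $H_X\in\mathbb F_2^{s\times n}$ with $H_XH_Z^{T}=0$, where every column of $H_Z$ has at most two nonzero entries (this covers all planar, rotated and toric surface codes, and the repetition code). Let $0<p<1/2$. The error $E\in\mathbb F_2^n$ (identified with its support) has independent coordinates, each equal to $1$ with probability $p$ and to $0$ with probability $1-p$; let $\sigma=H_ZE$ be its syndrome. *Decoding graph.* $G_D$ is the multigraph whose vertices are the rows of $H_Z$ together with a boundary vertex $b$; each qubit is an edge joining the (at most two) checks that detect it, missing endpoints being replaced by $b$, and each edge has weight $\omega=\log\frac{1-p}{p}>0$. For an edge set $N$ put $|N|_\omega=\sum_{e\in N}\omega(e)$. Let $V_\sigma$ be the set of checks $j$ with $\sigma_j\neq0$, together with $b$ if the number of these checks is odd. An edge set is *valid* if its degree (a loop counting twice) is odd at each vertex of $V_\sigma$ and even at every other vertex. A *logical operator* is an edge set whose indicator vector lies in $\ker H_Z$ but not in the row space of $H_X$. *Decoder.* Let $F$ be a correction returned by minimum weight perfect matching (MWPM), i.e. a valid edge set of minimum weight. Let $M$ be an edge set of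 minimum weight among all valid edge sets in a different logical class, i.e. whose symmetric difference with $F$ is a logical operator. *Clusters.* Let $\mathcal O$ be the set of odd-size subsets of $V_\sigma$; for distinct $u,v\in V_\sigma$ let $w_{uv}$ be the least weight of a path in $G_D$ from $u$ to $v$ ($\infty$ if there is none). Let $(y_S)_{S\in\mathcal O}$ be an optimal solution of the dual matching LP: maximize $\sum_{S\in\mathcal O}y_S$ subject to $y_S\ge0$ and $\sum_{S\in\mathcal O:\,|S\cap\{u,v\}|=1}y_S\le w_{uv}$ for all distinct $u,v\in V_\sigma$. Put $r_v=\sum_{S\in\mathcal O:\,v\in S}y_S$. Let $X$ be the metric space obtained from $G_D$ by regarding each edge $e$ as an interval of length $\omega(e)$, and let $\mathcal C\subseteq X$ be the union of the closed balls of radius $r_v$ around all vertices $v$. Write $|N\cap\mathcal C|_\omega$ for the total length of the part of an edge set $N$ lying in $\mathcal C$. *Soft output.* Let $X'$ be the quotient metric space of $X$ in which each connected component of $\mathcal C$ is identified with a point. Then $\phi(\sigma)$ is the length of the shortest path (the infimum of the lengths of continuous paths) in $X'$ that covers the image of some logical operator. **Theorem.** For all such $F$, $M$ and $y$, the quantity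 $\phi(\sigma)$ is finite and $$\log\frac{\Pr(E=F\mid\sigma)}{\Pr(E=M\mid\sigma)}=|M|_\omega-|F|_\omega\;\ge\;\phi(\sigma).$$ Moreover, every valid edge set $N$ satisfies $|N\cap\mathcal C|_\omega\ge\sum_{S\in\mathcal O}y_S\ge|F|_\omega$. -/

import Mathlib

open scoped NNReal ENNReal

noncomputable section

namespace SoftOutput

/-! ## Weighted multigraphs -/

/-- A weighted multigraph (parallel edges and loops are allowed) on vertices `V` with edges `E`.
Every edge carries an arbitrary orientation from `src e` to `tgt e` and a weight `weight e`. -/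
structure WGraph (V E : Type) where
  src : E → V
  tgt : E → V
  weight : E → ℝ

namespace WGraph

variable {V E : Type} (G : WGraph V E)

/-- The edge `e` can be traversed from `u` to `v` (in one of its two directions). -/
def Joins (e : E) (u v : V) : Prop :=
  (G.src e = u ∧ G.tgt e = v) ∨ (G.src e = v ∧ G.tgt e = u)

/-- Walks from `u` to `v` in the multigraph. -/
inductive Walk : V → V → Type
  | nil (u : V) : Walk u u
  | cons {u v w : V} (e : E) (h : G.Joins e u v) (p : Walk v w) : Walk u w

/-- The total weight of a walk. -/
def Walk.length {G : WGraph V E} : {u v : V} → G.Walk u v → ℝ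
  | _, _, .nil _ => 0
  | _, _, .cons e _ p => G.weight e + p.length

/-- The weight `w_e` of a vertex pair `e = (u, v)`: the least weight of a path from `u` to `v`
(equal to `∞` if there is none). -/
def pairWeight (u v : V) : ℝ≥0∞ := ⨅ p : G.Walk u v, ENNReal.ofReal p.length

/-- The weight `|N|_ω` of an edge set. -/
def edgeWeight (N : Finset E) : ℝ := ∑ e ∈ N, G.weight e

/-- The number of edges of `N` incident to `v`; a loop at `v` counts twice. -/
def degree [DecidableEq V] (N : Finset E) (v : V) : ℕ :=
  ∑ e ∈ N, ((if G.src e = v then 1 else 0) + (if G.tgt e = v then 1 else 0))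

/-- `N` is a valid edge set for the set `T` of nontrivial syndrome vertices: the number of edges
of `N` incident to `v` is odd for `v ∈ T` and even for `v ∉ T`. -/
def IsValid [DecidableEq V] (T : Finset V) (N : Finset E) : Prop :=
  ∀ v, Odd (G.degree N v) ↔ v ∈ T

end WGraph

/-! ## Gluing (pseudo-)metric spaces

Extended pseudo-metrics are used throughout; points at distance `0` represent the same point of
the quotient space. -/

section Glue

variable {P : Type}

open Classical in
/-- Cost of one step of a chain: free if it is one of the identifications `R`, and the distance
`d` otherwise. -/
def stepCost (d : P → P → ℝ≥0∞) (R : P → P → Prop) (x y : P) : ℝ≥0∞ :=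
  if R x y ∨ R y x then 0 else d x y

/-- The quotient metric: the distance after gluing points that are related by `R`, i.e. the infimum
of the costs of all finite chains `x = z 0, z 1, …, z k = y`. -/
def glueEDist (d : P → P → ℝ≥0∞) (R : P → P → Prop) (x y : P) : ℝ≥0∞ :=
  ⨅ (k : ℕ) (z : ℕ → P) (_ : z 0 = x) (_ : z k = y),
    ∑ i ∈ Finset.range k, stepCost d R (z i) (z (i + 1))

theorem glueEDist_le {d : P → P → ℝ≥0∞} {R : P → P → Prop} {x y : P} (k : ℕ) (z : ℕ → P)
    (h0 : z 0 = x) (hk : z k = y) :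
    glueEDist d R x y ≤ ∑ i ∈ Finset.range k, stepCost d R (z i) (z (i + 1)) :=
  iInf_le_of_le k <| iInf_le_of_le z <| iInf_le_of_le h0 <| iInf_le_of_le hk le_rfl

theorem glueEDist_self (d : P → P → ℝ≥0∞) (R : P → P → Prop) (x : P) :
    glueEDist d R x x = 0 := by
  have h := glueEDist_le (d := d) (R := R) (x := x) (y := x) 0 (fun _ => x) rfl rfl
  simpa using h

theorem glueEDist_comm_le {d : P → P → ℝ≥0∞} (hd : ∀ x y, d x y = d y x) (R : P → P → Prop)
    (x y : P) : glueEDist d R y x ≤ glueEDist d R x y := by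
  refine le_iInf fun k => le_iInf fun z => le_iInf fun h0 => le_iInf fun hk => ?_
  refine (glueEDist_le k (fun i => z (k - i)) (by simpa using hk) (by simpa using h0)).trans ?_
  rw [← Finset.sum_range_reflect]
  refine Finset.sum_le_sum fun i hi => ?_
  have hi' := Finset.mem_range.1 hi
  have e1 : k - (k - 1 - i) = i + 1 := by omega
  have e2 : k - (k - 1 - i + 1) = i := by omega
  simp only [e1, e2]
  unfold stepCost
  rw [hd (z (i + 1))]
  by_cases h : R (z i) (z (i + 1)) <;> by_cases h' : R (z (i + 1)) (z i) <;> simp [h, h']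

theorem glueEDist_triangle (d : P → P → ℝ≥0∞) (R : P → P → Prop) (x y w : P) :
    glueEDist d R x w ≤ glueEDist d R x y + glueEDist d R y w := by
  conv_rhs => unfold glueEDist
  simp only [ENNReal.iInf_add, ENNReal.add_iInf]
  refine le_iInf fun l => le_iInf fun z' => le_iInf fun h0' => le_iInf fun hl' => ?_
  refine le_iInf fun k => le_iInf fun z => le_iInf fun h0 => le_iInf fun hk => ?_
  refine (glueEDist_le (k + l) (fun i => if i ≤ k then z i else z' (i - k)) (by simpa using h0)
    ?_).trans ?_
  · rcases Nat.eq_zero_or_pos l with rfl | hl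
    · simp [hk, ← hl', ← h0']
    · simp [hl', hl.ne']
  · rw [Finset.sum_range_add]
    refine add_le_add (Finset.sum_le_sum fun i hi => ?_) (Finset.sum_le_sum fun i _ => ?_)
    · have hi' := Finset.mem_range.1 hi
      simp [hi'.le, Nat.succ_le_of_lt hi']
    · rcases Nat.eq_zero_or_pos i with rfl | h
      · simp [hk, h0']
      · have e1 : ¬ k + i ≤ k := by omega
        have e2 : ¬ k + i + 1 ≤ k := by omega
        have e3 : k + i + 1 - k = i + 1 := by omega
        simp [e1, e2, e3]

/-- The extended pseudo-metric space obtained by gluing. -/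
@[reducible] def glueSpace (d : P → P → ℝ≥0∞) (hd : ∀ x y, d x y = d y x) (R : P → P → Prop) :
    PseudoEMetricSpace P where
  edist := glueEDist d R
  edist_self := glueEDist_self d R
  edist_comm x y := le_antisymm (glueEDist_comm_le hd R y x) (glueEDist_comm_le hd R x y)
  edist_triangle := glueEDist_triangle d R

end Glue

/-! ## The metric space of a weighted graph -/

/-- Points of the disjoint union `V ⊔ ⨆ e, I_e` with `I_e = [0, weight e]`. -/
inductive Point {V E : Type} (G : WGraph V E) : Type
  | vertex (v : V) : Point G
  | edge (e : E) (t : Set.Icc (0 : ℝ) (G.weight e)) : Point G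

namespace Point

variable {V E : Type} {G : WGraph V E}

open Classical in
/-- Distance in the disjoint union `V ⊔ ⨆ e, I_e`: distinct pieces are infinitely far apart. -/
def unionDist : Point G → Point G → ℝ≥0∞
  | .vertex u, .vertex v => if u = v then 0 else ∞
  | .edge e s, .edge f t => if e = f then ENNReal.ofReal |s.1 - t.1| else ∞
  | .vertex _, .edge _ _ => ∞
  | .edge _ _, .vertex _ => ∞

theorem unionDist_comm (x y : Point G) : unionDist x y = unionDist y x := by
  rcases x with u | ⟨e, s⟩ <;> rcases y with v | ⟨f, t⟩ <;> simp only [unionDist]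
  · by_cases h : u = v
    · simp [h]
    · simp [h, Ne.symm h]
  · by_cases h : e = f
    · simp [h, abs_sub_comm]
    · simp [h, Ne.symm h]

/-- The point `0` of `I_e` is identified with `src e`, the point `weight e` with `tgt e`. -/
def Endpoint : Point G → Point G → Prop
  | .edge e t, .vertex v => (t.1 = 0 ∧ G.src e = v) ∨ (t.1 = G.weight e ∧ G.tgt e = v)
  | _, _ => False

/-- The metric space `X_G`: the intervals `I_e` glued together at the vertices. -/
instance : PseudoEMetricSpace (Point G) := glueSpace unionDist unionDist_comm Endpoint

end Point

section Clusters

variable {V E : Type} (G : WGraph V E)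

/-- The cluster set: the union of the closed balls of radius `r v` about all vertices `v`.
The clusters are its connected components. -/
def clusterSet (r : V → ℝ≥0) : Set (Point G) :=
  ⋃ v, Metric.closedEBall (Point.vertex v) (r v : ℝ≥0∞)

variable {G}

/-- The weight (length) `|N ∩ C|_ω` of the part of the edge set `N` that lies in `C`. -/
def weightInside (N : Finset E) (C : Set (Point G)) : ℝ :=
  ∑ e ∈ N, MeasureTheory.volume.real
    {t : ℝ | ∃ h : t ∈ Set.Icc (0 : ℝ) (G.weight e), Point.edge e ⟨t, h⟩ ∈ C}

/-- `x` and `y` lie in the same connected component of `C`. -/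
def SameComponent (C : Set (Point G)) (x y : Point G) : Prop :=
  x ∈ C ∧ y ∈ connectedComponentIn C x

/-- The quotient `X'_G` of `X_G` in which every connected component of `C` is a single point. -/
def Contracted (_C : Set (Point G)) : Type := Point G

instance (C : Set (Point G)) : PseudoEMetricSpace (Contracted C) :=
  glueSpace (P := Point G) (fun x y => edist x y) edist_comm (SameComponent C)

/-- The image of a point of `X_G` in the quotient. -/
def toContracted (C : Set (Point G)) (x : Point G) : Contracted C := x

/-- The path `γ : [0, T] → X'_G` covers the image of every point on every edge of `L`. -/
def Covers {C : Set (Point G)} (γ : ℝ → Contracted C) (T : ℝ) (L : Finset E) : Prop :=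
  ∀ e ∈ L, ∀ t : Set.Icc (0 : ℝ) (G.weight e),
    ∃ s ∈ Set.Icc (0 : ℝ) T, edist (γ s) (toContracted C (Point.edge e t)) = 0

/-- The soft output: the length of the shortest path in the quotient `X'_G` that covers a logical
operator, where `logical L` says that the edge set `L` is a logical operator. The infimum is `∞` if
there is no such path. -/
def softOutput (logical : Finset E → Prop) (C : Set (Point G)) : ℝ≥0∞ :=
  ⨅ (T : ℝ) (_ : 0 ≤ T) (γ : ℝ → Contracted C) (_ : ContinuousOn γ (Set.Icc 0 T))
    (_ : ∃ L : Finset E, logical L ∧ Covers γ T L), eVariationOn γ (Set.Icc 0 T)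

end Clusters

/-! ## The dual linear program of the matching problem -/

section Dual

variable {V E : Type} [DecidableEq V]

/-- The set `O` of all subsets of `T` of odd cardinality. -/
def oddSubsets (T : Finset V) : Finset (Finset V) :=
  T.powerset.filter fun S => Odd S.card

/-- The set `δ(u, v)` of all odd subsets of `T` that contain exactly one of `u` and `v`. -/
def delta (T : Finset V) (u v : V) : Finset (Finset V) :=
  (oddSubsets T).filter fun S => (u ∈ S ∧ v ∉ S) ∨ (u ∉ S ∧ v ∈ S)

/-- The objective of the dual program. -/
def dualObjective (T : Finset V) (y : Finset V → ℝ≥0) : ℝ≥0 := ∑ S ∈ oddSubsets T, y S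

/-- Feasibility for the dual program: `y S ≥ 0` (built into the type), and every pair of distinct
elements of `T` has nonnegative slack. Only the values of `y` on odd subsets of `T` matter. -/
def IsDualFeasible (G : WGraph V E) (T : Finset V) (y : Finset V → ℝ≥0) : Prop :=
  ∀ u ∈ T, ∀ v ∈ T, u ≠ v → ((∑ S ∈ delta T u v, y S : ℝ≥0) : ℝ≥0∞) ≤ G.pairWeight u v

/-- An optimal solution of the dual program. -/
def IsDualOptimal (G : WGraph V E) (T : Finset V) (y : Finset V → ℝ≥0) : Prop :=
  IsDualFeasible G T y ∧ ∀ y', IsDualFeasible G T y' → dualObjective T y' ≤ dualObjective T y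

/-- The radius of a vertex: the sum of `y S` over all odd sets `S` that contain it. -/
def dualRadius (T : Finset V) (y : Finset V → ℝ≥0) (v : V) : ℝ≥0 :=
  ∑ S ∈ (oddSubsets T).filter (fun S => v ∈ S), y S

end Dual

/-! ## Surface codes and bit-flip noise -/

/-- The check matrices of a surface code on `n` qubits: a CSS code such that every single-qubit `X`
error is detected by at most two `Z` checks. All planar (rotated or not) and toric surface codes are
of this form, and so is the repetition code. -/
structure SurfaceCode (r s n : ℕ) where
  HZ : Matrix (Fin r) (Fin n) (ZMod 2)
  HX : Matrix (Fin s) (Fin n) (ZMod 2)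
  commute : HX * HZ.transpose = 0
  colWeight_le : ∀ i, (Finset.univ.filter fun j => HZ j i ≠ 0).card ≤ 2

/-- The weight `log ((1 - p) / p)` of an edge whose error occurs with probability `p`. -/
def logWeight (p : ℝ) : ℝ := Real.log ((1 - p) / p)

/-- The error vector of an edge set. -/
def errorVec {n : ℕ} (N : Finset (Fin n)) : Fin n → ZMod 2 := fun i => if i ∈ N then 1 else 0

/-- The stochastic bit-flip model: every bit is `1` with probability `p` and `0` with probability
`1 - p`, independently. -/
def bitFlip (n : ℕ) (p : ℝ) : MeasureTheory.Measure (Fin n → ZMod 2) :=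
  MeasureTheory.Measure.pi fun _ =>
    ENNReal.ofReal (1 - p) • MeasureTheory.Measure.dirac 0 +
      ENNReal.ofReal p • MeasureTheory.Measure.dirac 1

namespace SurfaceCode

variable {r s n : ℕ} (code : SurfaceCode r s n)

/-- The `Z` checks that detect an `X` error on qubit `i`. -/
def checks (i : Fin n) : Finset (Fin r) := Finset.univ.filter fun j => code.HZ j i ≠ 0

/-- The decoding graph. Its vertices are the `Z` checks and the boundary vertex `⊤`; qubit `i` is an
edge between the (at most two) checks that detect it, missing endpoints being replaced by the
boundary vertex. All edges have weight `log ((1 - p) / p)`. -/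
def decodingGraph (p : ℝ) : WGraph (WithTop (Fin r)) (Fin n) where
  src i := (code.checks i).min
  tgt i := ((code.checks i).filter fun j : Fin r => (code.checks i).min < (j : WithTop (Fin r))).min
  weight _ := logWeight p

/-- A nontrivial logical (`X`-type) operator: it commutes with all `Z` checks and is not a product
of `X` stabilizer generators. -/
def IsLogical (L : Finset (Fin n)) : Prop :=
  code.HZ.mulVec (errorVec L) = 0 ∧
    errorVec L ∉ Submodule.span (ZMod 2) (Set.range fun k => code.HX k)

/-- The set of vertices at which the syndrome `σ` is nontrivial. The boundary vertex corresponds to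
the redundant check that is the sum of all the others, so it belongs to this set if and only if the
number of nontrivial syndrome bits is odd. -/
def syndromeVertices (σ : Fin r → ZMod 2) : Finset (WithTop (Fin r)) :=
  let T : Finset (WithTop (Fin r)) := (Finset.univ.filter fun j => σ j ≠ 0).image (↑)
  if Odd T.card then insert ⊤ T else T

/-- A valid edge set for the syndrome `σ`. -/
def IsValid (p : ℝ) (σ : Fin r → ZMod 2) (N : Finset (Fin n)) : Prop :=
  (code.decodingGraph p).IsValid (syndromeVertices σ) N

/-- `F` is a correction returned by the minimum weight perfect matching decoder: a valid edge set
of minimum weight. -/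
def IsMWPMCorrection (p : ℝ) (σ : Fin r → ZMod 2) (F : Finset (Fin n)) : Prop :=
  code.IsValid p σ F ∧ ∀ N, code.IsValid p σ N →
    (code.decodingGraph p).edgeWeight F ≤ (code.decodingGraph p).edgeWeight N

/-- `N` is a valid edge set in a logical class different from that of `F`. -/
def IsOpposite (p : ℝ) (σ : Fin r → ZMod 2) (F N : Finset (Fin n)) : Prop :=
  code.IsValid p σ N ∧ code.IsLogical (symmDiff N F)

/-- `M` has minimum weight among the valid edge sets in a logical class different from that
of `F`. -/
def IsMinOpposite (p : ℝ) (σ : Fin r → ZMod 2) (F M : Finset (Fin n)) : Prop :=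
  code.IsOpposite p σ F M ∧ ∀ N, code.IsOpposite p σ F N →
    (code.decodingGraph p).edgeWeight M ≤ (code.decodingGraph p).edgeWeight N

/-- The conditional probability `Pr(E = N | σ)` that the error is `N` given that its syndrome
is `σ`. -/
def condProb (p : ℝ) (σ : Fin r → ZMod 2) (N : Finset (Fin n)) : ℝ :=
  (ProbabilityTheory.cond (bitFlip n p) {x | code.HZ.mulVec x = σ}).real {errorVec N}

/-- The cluster set of a solution `y` of the dual program. -/
def clusters (p : ℝ) (σ : Fin r → ZMod 2) (y : Finset (WithTop (Fin r)) → ℝ≥0) :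
    Set (Point (code.decodingGraph p)) :=
  clusterSet (code.decodingGraph p) (dualRadius (syndromeVertices σ) y)

/-- The soft output `φ(σ)` computed from a solution `y` of the dual program. -/
def phi (p : ℝ) (σ : Fin r → ZMod 2) (y : Finset (WithTop (Fin r)) → ℝ≥0) : ℝ≥0∞ :=
  softOutput code.IsLogical (code.clusters p σ y)

end SurfaceCode

end SoftOutput

end

/-!
The log-likelihood ratio is the difference of the two weights because the probability of an error
with `k` flipped bits is `(1 - p) ^ n` times `exp (-k ω)`, where `ω` is the weight of an edge. The
bound on the soft output rests on the duality between matchings and the program for `y`, in two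
halves.

*Weak duality, localized in the clusters* (`WGraph.dualObjective_le_sum_coveredLength`). A valid
edge set `N` contains edge-disjoint trails that pair up the set `T` of syndrome vertices. An odd
set `S` separates the ends `u`, `v` of one of these trails, and the dual weight that separates `u`
from `v` is at most the length of the trail, by feasibility, and at most `r u + r v`. As the two
ends of the trail lie in the balls about `u` and `v`, the part of `N` inside the clusters has
length at least `∑ y S`. Instead of the exact intersection with the clusters, the proof uses for
each edge two end segments, whose lengths `d (src e)` and `d (tgt e)` are the depths of its
endpoints in the clusters (`WGraph.exists_depth`, `WGraph.coveredLength`). This makes the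
uncovered part of an edge an interval, so that its length in the contracted space can be read off.

*Strong duality* (`WGraph.exists_dual_eq_edgeWeight`). All edges have the same weight, so cutting
every edge in half gives a bipartite graph to which Seymour's theorem on packing cuts applies
(`WGraph.IsMinimumJoin.exists_cuts`). It provides `2 |F|` disjoint cuts, each met once by the
divided `F`; the traces on `T` of their vertex sets are odd sets, and weight `ω / 2` on each of
them is a feasible dual solution of value `|F|_ω`. Seymour's theorem is proved by Sebő's
induction, in which a suitable leaf of `F` is found and its star is contracted
(`WGraph.IsMinimumJoin.exists_leaf`, `WGraph.IsMinimumJoin.contract`).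

By both halves, the covered lengths of `F` and of `M` are at least `|F|_ω`. So `F` is covered
completely and `M` has at most `|M|_ω - |F|_ω` uncovered, which bounds the uncovered length of the
logical operator `M ∆ F`. That operator need not be connected, but it is a union of closed trails,
and one of these is itself logical (`SurfaceCode.exists_logical_trail`). Following it gives a path
in the contracted space that is no longer than its uncovered length (`WGraph.Trail.exists_path`).
-/

namespace SoftOutput

namespace WGraph

/-! ### Boundaries of edge sets -/

section Incidence

variable {V E : Type} (G : WGraph V E)

/-- The edge `e` has `v` as an endpoint. -/
def Incident (e : E) (v : V) : Prop := G.src e = v ∨ G.tgt e = v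

theorem Joins.symm {G : WGraph V E} {e : E} {u v : V} (h : G.Joins e u v) : G.Joins e v u :=
  Or.symm h

theorem Joins.incident_left {G : WGraph V E} {e : E} {u v : V} (h : G.Joins e u v) :
    G.Incident e u := h.imp And.left And.right

theorem Joins.incident_right {G : WGraph V E} {e : E} {u v : V} (h : G.Joins e u v) :
    G.Incident e v := h.symm.incident_left

theorem Incident.exists_joins {G : WGraph V E} {e : E} {u : V} (h : G.Incident e u) :
    ∃ v, G.Joins e u v := by
  rcases h with h | h
  · exact ⟨_, Or.inl ⟨h, rfl⟩⟩
  · exact ⟨_, Or.inr ⟨rfl, h⟩⟩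

theorem Joins.eq_of_incident {G : WGraph V E} {e : E} {u v w : V} (h : G.Joins e u v)
    (hw : G.Incident e w) : w = u ∨ w = v := by
  rcases h with ⟨rfl, rfl⟩ | ⟨rfl, rfl⟩ <;> rcases hw with rfl | rfl <;> simp

end Incidence

section Boundary

variable {V E : Type} [DecidableEq V] (G : WGraph V E)

/-- The boundary of an edge set: the degree modulo `2` at every vertex. -/
def boundary (N : Finset E) : V → ZMod 2 :=
  ∑ e ∈ N, (Pi.single (G.src e) 1 + Pi.single (G.tgt e) 1)

theorem boundary_apply (N : Finset E) (v : V) : G.boundary N v = (G.degree N v : ZMod 2) := by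
  simp only [boundary, degree, Finset.sum_apply, Pi.add_apply, Pi.single_apply]
  push_cast
  simp [eq_comm]

theorem isValid_iff {T : Finset V} {N : Finset E} :
    G.IsValid T N ↔ ∀ v, G.boundary N v = if v ∈ T then 1 else 0 := by
  refine forall_congr' fun v => ?_
  rw [boundary_apply]
  split_ifs with h
  · simp [h, ZMod.natCast_eq_one_iff_odd]
  · simp [h, ZMod.natCast_eq_zero_iff_even]

theorem pi_add_self {ι : Type} (x : ι → ZMod 2) : x + x = 0 :=
  funext fun i => CharTwo.add_self_eq_zero (x i)

theorem pi_eq_of_add_eq_zero {ι : Type} {x y : ι → ZMod 2} (h : x + y = 0) : x = y := by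
  linear_combination h - pi_add_self y

@[simp] theorem boundary_empty : G.boundary ∅ = 0 := rfl

theorem boundary_eq_zero_of_not_incident {N : Finset E} {v : V}
    (h : ∀ e ∈ N, ¬ G.Incident e v) : G.boundary N v = 0 := by
  simp only [boundary, Finset.sum_apply, Pi.add_apply]
  refine Finset.sum_eq_zero fun e he => ?_
  have := h e he
  simp only [Incident, not_or] at this
  simp [Ne.symm this.1, Ne.symm this.2]

theorem Joins.single_add_single {G : WGraph V E} {e : E} {u v : V} (h : G.Joins e u v) :
    (Pi.single (G.src e) 1 + Pi.single (G.tgt e) 1 : V → ZMod 2) =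
      Pi.single u 1 + Pi.single v 1 := by
  rcases h with ⟨rfl, rfl⟩ | ⟨rfl, rfl⟩
  · rfl
  · exact add_comm _ _

variable [DecidableEq E]

theorem boundary_insert {N : Finset E} {e : E} {u v : V} (he : e ∉ N) (h : G.Joins e u v) :
    G.boundary (insert e N) = Pi.single u 1 + Pi.single v 1 + G.boundary N := by
  rw [boundary, Finset.sum_insert he, h.single_add_single, boundary]

theorem boundary_union {N M : Finset E} (h : Disjoint N M) :
    G.boundary (N ∪ M) = G.boundary N + G.boundary M := Finset.sum_union h

theorem boundary_sdiff {N M : Finset E} (h : M ⊆ N) :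
    G.boundary (N \ M) = G.boundary N + G.boundary M := by
  have := G.boundary_union (Finset.sdiff_disjoint (s := M) (t := N))
  rw [Finset.sdiff_union_of_subset h] at this
  linear_combination -this - pi_add_self (G.boundary M)

theorem boundary_symmDiff (N M : Finset E) :
    G.boundary (symmDiff N M) = G.boundary N + G.boundary M := by
  have h1 := G.boundary_union (N := N \ M) (M := M \ N) (disjoint_sdiff_sdiff)
  have h2 := G.boundary_union (N := N \ M) (M := N ∩ M) (Finset.disjoint_sdiff_inter N M)
  have h3 := G.boundary_union (N := M \ N) (M := M ∩ N) (Finset.disjoint_sdiff_inter M N)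
  rw [Finset.sdiff_union_inter] at h2 h3
  rw [Finset.inter_comm M N] at h3
  have : symmDiff N M = N \ M ∪ M \ N := rfl
  rw [this, h1, h2, h3]
  linear_combination - pi_add_self (G.boundary (N ∩ M))

end Boundary

/-! ### Trails -/

section Trails

variable {V E : Type} [DecidableEq E] (G : WGraph V E)

/-- `G.Trail u v N`: the edge set `N` can be ordered and oriented to form a walk from `u` to `v`
that uses each of its edges exactly once. -/
inductive Trail : V → V → Finset E → Prop
  | nil (u : V) : Trail u u ∅
  | cons {u v w : V} {e : E} {N : Finset E} (h : G.Joins e u v) (he : e ∉ N) (p : Trail v w N) :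
      Trail u w (insert e N)

variable {G}

theorem Trail.eq_of_empty {u v : V} (p : G.Trail u v ∅) : u = v := by
  generalize h : (∅ : Finset E) = N at p
  cases p with
  | nil => rfl
  | cons => exact absurd h.symm (Finset.insert_ne_empty _ _)

theorem Trail.exists_walk {u v : V} {N : Finset E} (p : G.Trail u v N) :
    ∃ q : G.Walk u v, q.length = G.edgeWeight N := by
  induction p with
  | nil u => exact ⟨.nil u, by simp [Walk.length, edgeWeight]⟩
  | cons h he p ih =>
    obtain ⟨q, hq⟩ := ih
    exact ⟨.cons _ h q, by simp [Walk.length, edgeWeight, Finset.sum_insert he, hq]⟩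

theorem Trail.map {V' : Type} {u v : V} {N : Finset E} (p : G.Trail u v N) (φ : V → V') :
    Trail (⟨φ ∘ G.src, φ ∘ G.tgt, G.weight⟩ : WGraph V' E) (φ u) (φ v) N := by
  induction p with
  | nil u => exact .nil _
  | cons h he p ih =>
    refine .cons ?_ he ih
    rcases h with ⟨rfl, rfl⟩ | ⟨rfl, rfl⟩
    · exact Or.inl ⟨rfl, rfl⟩
    · exact Or.inr ⟨rfl, rfl⟩

theorem Trail.boundary_eq [DecidableEq V] {u v : V} {N : Finset E} (p : G.Trail u v N) :
    G.boundary N = Pi.single u 1 + Pi.single v 1 := by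
  induction p with
  | nil u => rw [boundary_empty, pi_add_self]
  | @cons u v w e N h he p ih =>
    rw [G.boundary_insert he h, ih]
    linear_combination pi_add_self (Pi.single v 1)

/-- A trail can be cut at any vertex that it visits. -/
theorem Trail.split {u v : V} {N : Finset E} (p : G.Trail u v N) {z : V}
    (hz : ∃ e ∈ N, G.Incident e z) :
    ∃ N₁ N₂, Disjoint N₁ N₂ ∧ N₁ ∪ N₂ = N ∧ G.Trail u z N₁ ∧ G.Trail z v N₂ := by
  induction p with
  | nil u => simp at hz
  | @cons u v w e N h he p ih =>
    by_cases huz : u = z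
    · subst huz
      exact ⟨∅, insert e N, by simp, by simp, .nil _, .cons h he p⟩
    by_cases hvz : v = z
    · subst hvz
      exact ⟨{e}, N, by simpa using he, rfl, .cons h (by simp) (.nil _), p⟩
    obtain ⟨g, hg, hgz⟩ := hz
    rcases Finset.mem_insert.1 hg with rfl | hg
    · rcases h.eq_of_incident hgz with h | h
      · exact absurd h.symm huz
      · exact absurd h.symm hvz
    · obtain ⟨N₁, N₂, hd, rfl, p₁, p₂⟩ := ih ⟨g, hg, hgz⟩
      simp only [Finset.mem_union, not_or] at he
      refine ⟨insert e N₁, N₂, ?_, by rw [Finset.insert_union], .cons h he.1 p₁, p₂⟩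
      exact Finset.disjoint_insert_left.2 ⟨he.2, hd⟩

/-- Either a trail meets the vertex set `H`, and can be cut at the first vertex in `H`, or it avoids
`H` altogether. -/
theorem Trail.first_hit {u v : V} {N : Finset E} (p : G.Trail u v N) (H : V → Prop) :
    (∃ z N₁ N₂, H z ∧ Disjoint N₁ N₂ ∧ N₁ ∪ N₂ = N ∧ G.Trail u z N₁ ∧ G.Trail z v N₂ ∧
      ∀ e ∈ N₁, ∃ x, G.Incident e x ∧ ¬ H x) ∨
    ¬ H v ∧ ∀ e ∈ N, ∃ x, G.Incident e x ∧ ¬ H x := by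
  induction p with
  | nil u =>
    by_cases hu : H u
    · exact Or.inl ⟨u, ∅, ∅, hu, by simp, by simp, .nil _, .nil _, by simp⟩
    · exact Or.inr ⟨hu, by simp⟩
  | @cons u v w e N h he p ih =>
    by_cases hu : H u
    · exact Or.inl ⟨u, ∅, insert e N, hu, by simp, by simp, .nil _, .cons h he p, by simp⟩
    rcases ih with ⟨z, N₁, N₂, hz, hd, rfl, p₁, p₂, hN⟩ | ⟨hw, hN⟩
    · simp only [Finset.mem_union, not_or] at he
      refine Or.inl ⟨z, insert e N₁, N₂, hz, Finset.disjoint_insert_left.2 ⟨he.2, hd⟩,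
        by rw [Finset.insert_union], .cons h he.1 p₁, p₂, ?_⟩
      exact Finset.forall_mem_insert _ _ _ |>.2 ⟨⟨u, h.incident_left, hu⟩, hN⟩
    · exact Or.inr ⟨hw, Finset.forall_mem_insert _ _ _ |>.2 ⟨⟨u, h.incident_left, hu⟩, hN⟩⟩

/-- Every vertex of odd degree is joined to another vertex of odd degree by a trail. -/
theorem exists_trail_of_boundary_ne_zero [DecidableEq V] {N : Finset E} {u : V}
    (hu : G.boundary N u ≠ 0) :
    ∃ v Q, v ≠ u ∧ G.boundary N v ≠ 0 ∧ Q ⊆ N ∧ G.Trail u v Q ∧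
      ∀ e ∈ Q, G.src e ≠ G.tgt e := by
  induction hk : N.card generalizing N u with
  | zero => simp [Finset.card_eq_zero.1 hk] at hu
  | succ k ih =>
    obtain ⟨e, he, hne⟩ : ∃ e ∈ N, (Pi.single (G.src e) 1 + Pi.single (G.tgt e) 1 :
        V → ZMod 2) u ≠ 0 := by
      by_contra! h
      exact hu (by rw [boundary, Finset.sum_apply]; exact Finset.sum_eq_zero h)
    have hl : G.src e ≠ G.tgt e := by
      intro h
      rw [h, pi_add_self] at hne
      exact hne rfl
    have hinc : G.Incident e u := by
      by_contra hc
      simp only [Incident, not_or] at hc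
      simp [Ne.symm hc.1, Ne.symm hc.2] at hne
    obtain ⟨x, hx⟩ := hinc.exists_joins
    have hux : u ≠ x := by
      rintro rfl
      rcases hx with ⟨h1, h2⟩ | ⟨h1, h2⟩ <;> exact hl (h1.trans h2.symm)
    by_cases hbx : G.boundary N x = 0
    · have hb : G.boundary (N.erase e) =
          Pi.single u 1 + Pi.single x 1 + G.boundary N := by
        have := G.boundary_insert (Finset.notMem_erase e N) hx
        rw [Finset.insert_erase he] at this
        rw [this]
        linear_combination -pi_add_self (Pi.single u 1) - pi_add_self (Pi.single x 1)
      have hbx' : G.boundary (N.erase e) x ≠ 0 := by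
        simp [hb, hbx, hux.symm]
      obtain ⟨v, Q, hvx, hv, hQ, p, hQl⟩ := ih hbx' (by rw [Finset.card_erase_of_mem he, hk]; rfl)
      have hvu : v ≠ u := by
        rintro rfl
        apply hv
        have h1 : G.boundary N v = 1 := by
          generalize G.boundary N v = a at hu
          revert a; decide
        simp only [hb, Pi.add_apply, Pi.single_apply, h1, if_neg hux]
        simp; decide
      refine ⟨v, insert e Q, hvu, ?_, ?_, .cons hx (fun h => ?_) p, ?_⟩
      · simpa [hb, hvu, hvx, Pi.single_apply] using hv
      · exact Finset.insert_subset he (hQ.trans (Finset.erase_subset _ _))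
      · exact Finset.notMem_erase _ _ (hQ h)
      · exact Finset.forall_mem_insert _ _ _ |>.2 ⟨hl, hQl⟩
    · exact ⟨x, {e}, hux.symm, hbx, by simpa using he,
        .cons hx (by simp) (.nil _), by simpa using hl⟩

/-- Every nonempty edge set without boundary contains a nonempty closed trail. -/
theorem exists_closed_trail [DecidableEq V] {N : Finset E} (hN : N.Nonempty)
    (hb : G.boundary N = 0) : ∃ v Q, Q.Nonempty ∧ Q ⊆ N ∧ G.Trail v v Q := by
  obtain ⟨e, he⟩ := hN
  by_cases hl : G.src e = G.tgt e
  · exact ⟨G.src e, {e}, by simp, by simpa using he,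
      .cons (Or.inl ⟨rfl, hl.symm⟩) (by simp) (.nil _)⟩
  have hj : G.Joins e (G.tgt e) (G.src e) := Or.inr ⟨rfl, rfl⟩
  have hb' : G.boundary (N.erase e) = Pi.single (G.tgt e) 1 + Pi.single (G.src e) 1 := by
    have := G.boundary_insert (Finset.notMem_erase e N) hj
    rw [Finset.insert_erase he, hb] at this
    exact (pi_eq_of_add_eq_zero this.symm).symm
  have hs : G.boundary (N.erase e) (G.src e) ≠ 0 := by simp [hb', hl]
  obtain ⟨v, Q, hvs, hv, hQ, p, -⟩ := exists_trail_of_boundary_ne_zero hs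
  have hvt : v = G.tgt e := by
    by_contra h
    simp [hb', h, hvs] at hv
  subst hvt
  exact ⟨G.tgt e, insert e Q, by simp, Finset.insert_subset he (hQ.trans (Finset.erase_subset _ _)),
    .cons hj (fun h => Finset.notMem_erase _ _ (hQ h)) p⟩

end Trails

/-! ### Packing cuts in a bipartite graph -/

section Packing

variable {V E : Type} [DecidableEq V] [DecidableEq E] (G : WGraph V E)

/-- The size of `N`, where the edges of `F` count negatively. -/
def signedCard (F N : Finset E) : ℤ := ∑ e ∈ N, if e ∈ F then -1 else 1

/-- `F` has the fewest edges among the sets with the same boundary, expressed without comparing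
sets: no edge set without boundary has more edges inside `F` than outside. -/
def IsMinimumJoin (F : Finset E) : Prop := ∀ Z, G.boundary Z = 0 → 0 ≤ signedCard F Z

/-- The edge `e` belongs to the cut of the vertex set `U`. -/
def Crosses (U : Set V) (e : E) : Prop := ¬ (G.src e ∈ U ↔ G.tgt e ∈ U)

/-- `c` is a proper two-colouring, loops being disregarded. -/
def IsBicoloring (c : V → Bool) : Prop := ∀ e, G.src e = G.tgt e ∨ c (G.src e) ≠ c (G.tgt e)

omit [DecidableEq V] in
theorem signedCard_insert {F N : Finset E} {e : E} (he : e ∉ N) :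
    signedCard F (insert e N) = (if e ∈ F then -1 else 1) + signedCard F N :=
  Finset.sum_insert he

theorem signedCard_union {F N M : Finset E} (h : Disjoint N M) :
    signedCard F (N ∪ M) = signedCard F N + signedCard F M := Finset.sum_union h

theorem signedCard_sdiff {F N M : Finset E} (h : M ⊆ N) :
    signedCard F (N \ M) = signedCard F N - signedCard F M :=
  eq_sub_of_add_eq (Finset.sum_sdiff h)

variable {G}

omit [DecidableEq V] in
/-- Every edge of a loopless trail changes both the colour and the parity of the signed size. -/
theorem Trail.even_signedCard_iff {c : V → Bool} (hc : G.IsBicoloring c) {F Q : Finset E} {u v : V}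
    (p : G.Trail u v Q) (hQ : ∀ e ∈ Q, G.src e ≠ G.tgt e) :
    Even (signedCard F Q) ↔ c u = c v := by
  induction p with
  | nil u => simp [signedCard]
  | @cons u v w e N h he p ih =>
    have ih := ih fun e he => hQ e (Finset.mem_insert_of_mem he)
    have hne : c u ≠ c v := by
      have h1 := (hc e).resolve_left (hQ e (Finset.mem_insert_self _ _))
      rcases h with ⟨rfl, rfl⟩ | ⟨rfl, rfl⟩
      · exact h1
      · exact h1.symm
    have hodd : ¬ Even (if e ∈ F then -1 else 1 : ℤ) := by split_ifs <;> decide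
    rw [signedCard_insert he, Int.even_add, ih]
    simp only [hodd, false_iff]
    revert hne
    cases c u <;> cases c v <;> cases c w <;> simp

/-- If every trail between distinct vertices has signed size at least `m < 0`, then so has every
edge set whose boundary is that of a trail. -/
theorem IsMinimumJoin.le_signedCard {F : Finset E} (hF : G.IsMinimumJoin F) {m : ℤ} (hm : m < 0)
    (hmin : ∀ x y N, x ≠ y → G.Trail x y N → m ≤ signedCard F N) {x y : V} {N : Finset E}
    (hN : G.boundary N = Pi.single x 1 + Pi.single y 1) : m ≤ signedCard F N := by
  by_cases hxy : x = y
  · subst hxy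
    exact hm.le.trans (hF N (by rw [hN, pi_add_self]))
  · have hx : G.boundary N x ≠ 0 := by simp [hN, hxy]
    obtain ⟨v, Q, hvx, hv, hQ, p, -⟩ := exists_trail_of_boundary_ne_zero hx
    have hvy : v = y := by
      by_contra h
      simp [hN, h, hvx] at hv
    subst hvy
    have h1 := hmin _ _ _ hvx.symm p
    have h2 := hF (N \ Q) (by rw [G.boundary_sdiff hQ, hN, p.boundary_eq, pi_add_self])
    rw [signedCard_sdiff hQ] at h2
    linarith

/-- The end `b` of a trail of minimum signed size, with the fewest edges among those: it is
incident to a single edge `f` of `F`, and every trail that joins two distinct neighbours of `b`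
and avoids `b` has nonnegative signed size. -/
theorem IsMinimumJoin.exists_leaf [Fintype E] {F : Finset E} (hF : G.IsMinimumJoin F)
    {c : V → Bool} (hc : G.IsBicoloring c) (hne : F.Nonempty) :
    ∃ f ∈ F, ∃ b x, b ≠ x ∧ G.Joins f b x ∧ (∀ g ∈ F, G.Incident g b → g = f) ∧
      ∀ u v Q e₁ e₂, u ≠ v → u ≠ b → v ≠ b → G.Joins e₁ b u → G.Joins e₂ b v → G.Trail u v Q →
        (∀ e ∈ Q, ¬ G.Incident e b) → (∀ e ∈ Q, G.src e ≠ G.tgt e) → 0 ≤ signedCard F Q := by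
  classical
  have hloop : ∀ f ∈ F, G.src f ≠ G.tgt f := by
    intro f hf h
    have h1 := hF {f} (by rw [boundary, Finset.sum_singleton, h, pi_add_self])
    simp [signedCard, hf] at h1
  set Ps : Finset (Finset E) := Finset.univ.filter fun P => ∃ b a, b ≠ a ∧ G.Trail b a P with hPs
  have hPne : Ps.Nonempty := by
    obtain ⟨f, hf⟩ := hne
    refine ⟨{f}, ?_⟩
    simp only [hPs, Finset.mem_filter, Finset.mem_univ, true_and]
    exact ⟨_, _, hloop f hf, .cons (Or.inl ⟨rfl, rfl⟩) (by simp) (.nil _)⟩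
  obtain ⟨P, hP, hPmin⟩ := Finset.exists_min_image Ps
    (fun P => toLex (signedCard F P, P.card)) hPne
  simp only [hPs, Finset.mem_filter, Finset.mem_univ, true_and] at hP hPmin
  obtain ⟨b, a, hba, p⟩ := hP
  have hmin : ∀ x y N, x ≠ y → G.Trail x y N → signedCard F P ≤ signedCard F N := by
    intro x y N hxy q
    rcases (Prod.Lex.le_iff.1 (hPmin N ⟨x, y, hxy, q⟩)) with h | h
    · exact h.le
    · exact h.1.le
  have hcard : ∀ x y N, x ≠ y → G.Trail x y N → signedCard F N ≤ signedCard F P →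
      P.card ≤ N.card := by
    intro x y N hxy q hle
    rcases (Prod.Lex.le_iff.1 (hPmin N ⟨x, y, hxy, q⟩)) with h | h
    · exact absurd h (not_lt.2 hle)
    · exact h.2
  have hm : signedCard F P < 0 := by
    obtain ⟨f, hf⟩ := hne
    have := hmin _ _ {f} (hloop f hf) (.cons (Or.inl ⟨rfl, rfl⟩) (by simp) (.nil _))
    simp only [signedCard, Finset.sum_singleton, hf, if_true] at this ⊢
    linarith
  have hjoin := fun {x y : V} {N : Finset E} => hF.le_signedCard hm hmin (x := x) (y := y) (N := N)
  have hbP := p.boundary_eq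
  obtain ⟨f, P', x, hfx, hfP', p', rfl⟩ : ∃ f P' x, G.Joins f b x ∧ f ∉ P' ∧ G.Trail x a P' ∧
      P = insert f P' := by
    cases p with
    | nil => exact absurd rfl hba
    | cons h he p => exact ⟨_, _, _, h, he, p, rfl⟩
  have hfF : f ∈ F := by
    by_contra hf
    have := hjoin p'.boundary_eq
    rw [signedCard_insert hfP', if_neg hf] at this
    linarith
  have hbx : b ≠ x := by
    rintro rfl
    rcases hfx with ⟨h1, h2⟩ | ⟨h1, h2⟩ <;> exact hloop f hfF (h1.trans h2.symm)
  -- The trail does not return to `b`, because the closed part could be dropped.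
  have hP'b : ∀ e ∈ P', ¬ G.Incident e b := by
    intro e he heb
    obtain ⟨N₁, N₂, hd, rfl, p₁, p₂⟩ := p'.split ⟨e, he, heb⟩
    simp only [Finset.mem_union, not_or] at hfP'
    have h1 := hF (insert f N₁) (by
      rw [G.boundary_insert hfP'.1 hfx, p₁.boundary_eq]
      linear_combination pi_add_self (Pi.single x 1) + pi_add_self (Pi.single b 1))
    rw [← Finset.insert_union, signedCard_union (Finset.disjoint_insert_left.2 ⟨hfP'.2, hd⟩)]
      at hcard
    have h2 := hcard _ _ _ hba p₂ (by linarith)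
    rw [Finset.card_union_of_disjoint
      (Finset.disjoint_insert_left.2 ⟨hfP'.2, hd⟩), Finset.card_insert_of_notMem hfP'.1] at h2
    omega
  have huniq : ∀ g ∈ F, G.Incident g b → g = f := by
    intro g hg hgb
    by_contra hgf
    obtain ⟨y, hy⟩ := hgb.exists_joins
    have hgP : g ∉ insert f P' := by
      simp only [Finset.mem_insert, hgf, false_or]
      exact fun h => hP'b g h hgb
    have := hjoin (x := y) (y := a) (N := insert g (insert f P')) (by
      rw [G.boundary_insert hgP hy, hbP]
      linear_combination pi_add_self (Pi.single b 1))
    rw [signedCard_insert hgP, if_pos hg] at this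
    linarith
  refine ⟨f, hfF, b, x, hbx, hfx, huniq, ?_⟩
  intro u v Q e₁ e₂ huv hub hvb h₁ h₂ q hQb hQl
  by_contra! hneg
  have hcb : ∀ {e w}, w ≠ b → G.Joins e b w → c w = !c b := by
    intro e w hw h
    rcases h with ⟨rfl, rfl⟩ | ⟨rfl, rfl⟩
    · have := (hc e).resolve_left hw.symm
      revert this; cases c (G.src e) <;> cases c (G.tgt e) <;> simp
    · have := (hc e).resolve_left hw
      revert this; cases c (G.src e) <;> cases c (G.tgt e) <;> simp
  have heven : Even (signedCard F Q) :=
    (q.even_signedCard_iff hc hQl).2 ((hcb hub h₁).trans (hcb hvb h₂).symm)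
  have he₁₂ : e₁ ≠ e₂ := by
    rintro rfl
    rcases h₁.eq_of_incident h₂.incident_right with h | h
    · exact hvb h
    · exact huv h.symm
  have he₁Q : e₁ ∉ Q := fun h => hQb _ h h₁.incident_left
  have he₂Q : e₂ ∉ Q := fun h => hQb _ h h₂.incident_left
  have hZ := hF (insert e₁ (insert e₂ Q)) (by
    rw [G.boundary_insert (by simp [he₁₂, he₁Q]) h₁, G.boundary_insert he₂Q h₂, q.boundary_eq]
    linear_combination pi_add_self (Pi.single b 1) + pi_add_self (Pi.single u 1) +
      pi_add_self (Pi.single v 1))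
  rw [signedCard_insert (by simp [he₁₂, he₁Q]), signedCard_insert he₂Q] at hZ
  -- By parity, the closed trail through `b` formed by `Q`, `e₁` and `e₂` has signed size `0`,
  -- and `e₁`, `e₂` are not in `F`.
  obtain ⟨k, hk⟩ := heven
  have he₁F : e₁ ∉ F := by
    intro h; rw [if_pos h] at hZ; split_ifs at hZ <;> omega
  have he₂F : e₂ ∉ F := by
    intro h
    rw [if_pos h, if_neg he₁F] at hZ
    omega
  rw [if_neg he₁F, if_neg he₂F] at hZ
  have hQ2 : signedCard F Q = -2 := by omega
  have he₁P : e₁ ∉ insert f P' := by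
    simp only [Finset.mem_insert, not_or]
    exact ⟨fun h => he₁F (h ▸ hfF), fun h => hP'b _ h h₁.incident_left⟩
  have hdisj : ∀ N : Finset E, (∀ e ∈ N, ∃ z, G.Incident e z ∧ ¬ ∃ g ∈ Q, G.Incident g z) →
      Disjoint N Q := by
    intro N hN
    refine Finset.disjoint_left.2 fun e he heQ => ?_
    obtain ⟨z, hez, hz⟩ := hN e he
    exact hz ⟨e, heQ, hez⟩
  rcases p.first_hit (fun z => ∃ e ∈ Q, G.Incident e z) with
    ⟨z, P₁, P₂, hz, hd, hP, p₁, p₂, hav⟩ | ⟨-, hav⟩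
  · obtain ⟨Q₁, Q₂, hdQ, hQ, q₁, q₂⟩ := q.split hz
    have hP₁Q := hdisj P₁ hav
    have he₁P₁ : e₁ ∉ P₁ := fun h => he₁P (hP ▸ Finset.mem_union_left _ h)
    have hd₁ : Disjoint P₁ Q₁ := hP₁Q.mono_right (hQ ▸ Finset.subset_union_left)
    have hd₂ : Disjoint P₁ Q₂ := hP₁Q.mono_right (hQ ▸ Finset.subset_union_right)
    have he₂P₁ : e₂ ∉ P₁ := by
      refine fun h => ?_
      have : e₂ ∈ insert f P' := hP ▸ Finset.mem_union_left _ h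
      rcases Finset.mem_insert.1 this with h' | h'
      · exact he₂F (h' ▸ hfF)
      · exact hP'b _ h' h₂.incident_left
    have hn₁ : e₁ ∉ P₁ ∪ Q₁ := by
      simp only [Finset.mem_union, not_or]
      exact ⟨he₁P₁, fun h => he₁Q (hQ ▸ Finset.mem_union_left _ h)⟩
    have hn₂ : e₂ ∉ P₁ ∪ Q₂ := by
      simp only [Finset.mem_union, not_or]
      exact ⟨he₂P₁, fun h => he₂Q (hQ ▸ Finset.mem_union_right _ h)⟩
    have i₁ := hF (insert e₁ (P₁ ∪ Q₁)) (by
      rw [G.boundary_insert hn₁ h₁, G.boundary_union hd₁, p₁.boundary_eq, q₁.boundary_eq]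
      linear_combination pi_add_self (Pi.single b 1) + pi_add_self (Pi.single u 1) +
        pi_add_self (Pi.single z 1))
    have i₂ := hF (insert e₂ (P₁ ∪ Q₂)) (by
      rw [G.boundary_insert hn₂ h₂, G.boundary_union hd₂, p₁.boundary_eq, q₂.boundary_eq]
      linear_combination pi_add_self (Pi.single b 1) + pi_add_self (Pi.single v 1) +
        pi_add_self (Pi.single z 1))
    rw [signedCard_insert hn₁, signedCard_union hd₁, if_neg he₁F] at i₁
    rw [signedCard_insert hn₂, signedCard_union hd₂, if_neg he₂F] at i₂
    have hQs := signedCard_union (F := F) hdQ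
    have hPs := signedCard_union (F := F) hd
    rw [hQ] at hQs
    rw [hP] at hPs
    have hza : z ≠ a := by
      rintro rfl
      have := hF P₂ (by rw [p₂.boundary_eq, pi_add_self])
      linarith
    have h3 := hcard _ _ _ hza p₂ (by linarith)
    rw [← hP, Finset.card_union_of_disjoint hd] at h3
    have h4 : P₁ = ∅ := Finset.card_eq_zero.1 (by omega)
    subst h4
    obtain rfl := p₁.eq_of_empty
    obtain ⟨e, he, heb⟩ := hz
    exact hQb e he heb
  · have hPQ := hdisj _ hav
    have hn : e₁ ∉ insert f P' ∪ Q := by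
      rw [Finset.mem_union, not_or]
      exact ⟨he₁P, he₁Q⟩
    have := hjoin (x := a) (y := v) (N := insert e₁ (insert f P' ∪ Q)) (by
      rw [G.boundary_insert hn h₁, G.boundary_union hPQ, hbP, q.boundary_eq]
      linear_combination pi_add_self (Pi.single b 1) + pi_add_self (Pi.single u 1))
    rw [signedCard_insert hn, signedCard_union hPQ, if_neg he₁F] at this
    linarith

/-- The contraction step: when `f` is the only edge of `F` at `b` and the star of `b` is contracted,
`F` without `f` remains a minimum set with its boundary. -/
theorem IsMinimumJoin.contract {F : Finset E} (hF : G.IsMinimumJoin F) {f : E} {b x : V}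
    (huniq : ∀ g ∈ F, G.Incident g b → g = f)
    (hleaf : ∀ u v Q e₁ e₂, u ≠ v → u ≠ b → v ≠ b → G.Joins e₁ b u → G.Joins e₂ b v →
      G.Trail u v Q → (∀ e ∈ Q, ¬ G.Incident e b) → (∀ e ∈ Q, G.src e ≠ G.tgt e) →
      0 ≤ signedCard F Q) {φ : V → V} (hφ : ∀ v, (v = b ∨ ∃ e, G.Joins e b v) → φ v = x)
    (hφ' : ∀ v, ¬ (v = b ∨ ∃ e, G.Joins e b v) → φ v = v) (hfx : G.Joins f b x) :
    IsMinimumJoin (⟨φ ∘ G.src, φ ∘ G.tgt, G.weight⟩ : WGraph V E) (F.erase f) := by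
  classical
  set G' : WGraph V E := ⟨φ ∘ G.src, φ ∘ G.tgt, G.weight⟩ with hG'
  have key : ∀ k : ℕ, ∀ Z : Finset E, Z.card = k → G'.boundary Z = 0 →
      (∀ e ∈ Z, ¬ G.Incident e b) → 0 ≤ signedCard F Z := by
    intro k
    induction k using Nat.strong_induction_on with
    | _ k ih =>
      intro Z hk hZ hZb
      by_cases hZ0 : G.boundary Z = 0
      · exact hF Z hZ0
      have hnbr : ∀ u, G.boundary Z u ≠ 0 → u ≠ b ∧ ∃ e, G.Joins e b u := by
        intro u hu
        have hub : u ≠ b := by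
          rintro rfl
          exact hu (G.boundary_eq_zero_of_not_incident hZb)
        refine ⟨hub, ?_⟩
        by_contra hc
        have hcl : ¬ (u = b ∨ ∃ e, G.Joins e b u) := by
          rintro (h | h)
          · exact hub h
          · exact hc h
        have hiff : ∀ w, u = φ w ↔ u = w := by
          intro w
          by_cases hw : w = b ∨ ∃ e, G.Joins e b w
          · rw [hφ w hw]
            constructor
            · rintro rfl
              exact absurd (Or.inr ⟨f, hfx⟩) hcl
            · rintro rfl
              exact absurd hw hcl
          · rw [hφ' w hw]
        apply hu
        have h0 := congrFun hZ u
        simp only [boundary, Finset.sum_apply, Pi.add_apply, Pi.single_apply, hG',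
          Function.comp_apply, hiff, Pi.zero_apply] at h0 ⊢
        exact h0
      obtain ⟨u, hu⟩ := Function.ne_iff.1 hZ0
      obtain ⟨v, Q, hvu, hv, hQ, q, hQl⟩ := exists_trail_of_boundary_ne_zero hu
      obtain ⟨hub, e₁, h₁⟩ := hnbr u hu
      obtain ⟨hvb, e₂, h₂⟩ := hnbr v hv
      have hQ0 := hleaf u v Q e₁ e₂ hvu.symm hub hvb h₁ h₂ q (fun e he => hZb e (hQ he)) hQl
      have hQ' : G'.boundary Q = 0 := by
        have := (q.map φ).boundary_eq
        rw [hφ u (Or.inr ⟨_, h₁⟩), hφ v (Or.inr ⟨_, h₂⟩), pi_add_self] at this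
        exact this
      have hQne : Q.Nonempty := by
        rw [Finset.nonempty_iff_ne_empty]
        rintro rfl
        exact hvu q.eq_of_empty.symm
      have hlt : (Z \ Q).card < k := by
        rw [← hk]
        exact Finset.card_lt_card (Finset.sdiff_ssubset hQ hQne)
      have := ih _ hlt (Z \ Q) rfl (by rw [G'.boundary_sdiff hQ, hZ, hQ', add_zero])
        fun e he => hZb e (Finset.sdiff_subset he)
      rw [signedCard_sdiff hQ] at this
      linarith
  intro Z hZ
  set B := Z.filter fun e => G.Incident e b with hB
  have hBZ : B ⊆ Z := Finset.filter_subset _ _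
  have hB0 : G'.boundary B = 0 := by
    refine Finset.sum_eq_zero fun e he => ?_
    have heb := (Finset.mem_filter.1 he).2
    obtain ⟨y, hy⟩ := heb.exists_joins
    have h1 : φ (G.src e) = x ∧ φ (G.tgt e) = x := by
      rcases hy with ⟨h1, h2⟩ | ⟨h1, h2⟩
      · exact ⟨hφ _ (Or.inl h1), hφ _ (Or.inr ⟨e, Or.inl ⟨h1, rfl⟩⟩)⟩
      · exact ⟨hφ _ (Or.inr ⟨e, Or.inr ⟨rfl, h2⟩⟩), hφ _ (Or.inl h2)⟩
    simp only [hG', Function.comp_apply, h1.1, h1.2, pi_add_self]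
  have h1 := key _ (Z \ B) rfl (by rw [G'.boundary_sdiff hBZ, hZ, hB0, add_zero]) (by
    intro e he heb
    rw [Finset.mem_sdiff, hB, Finset.mem_filter] at he
    exact he.2 ⟨he.1, heb⟩)
  have h2 : signedCard (F.erase f) (Z \ B) = signedCard F (Z \ B) := by
    refine Finset.sum_congr rfl fun e he => ?_
    have hef : e ≠ f := by
      rintro rfl
      rw [Finset.mem_sdiff, hB, Finset.mem_filter] at he
      exact he.2 ⟨he.1, hfx.incident_left⟩
    simp [hef]
  have h3 : 0 ≤ signedCard (F.erase f) B := by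
    refine Finset.sum_nonneg fun e he => ?_
    have heb := (Finset.mem_filter.1 he).2
    rw [if_neg]
    · exact zero_le_one
    · rw [Finset.mem_erase]
      exact fun h => h.1 (huniq e h.2 heb)
  rw [signedCard_sdiff hBZ] at h2
  linarith

/-- **Seymour's theorem on packing cuts**: in a bipartite graph, a minimum set `F` with its boundary
is met exactly once by each of `|F|` pairwise disjoint cuts. The proof is Sebő's: contract the star
of a leaf as in `exists_leaf` and use induction. -/
theorem IsMinimumJoin.exists_cuts [Fintype E] {F : Finset E} (hF : G.IsMinimumJoin F)
    {c : V → Bool} (hc : G.IsBicoloring c) :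
    ∃ U : E → Set V, (∀ f ∈ F, ∀ g ∈ F, G.Crosses (U f) g ↔ g = f) ∧
      ∀ f ∈ F, ∀ g ∈ F, ∀ e, G.Crosses (U f) e → G.Crosses (U g) e → f = g := by
  classical
  induction hk : F.card generalizing F G with
  | zero =>
    obtain rfl := Finset.card_eq_zero.1 hk
    exact ⟨fun _ => ∅, by simp, by simp⟩
  | succ k ih =>
    have hne : F.Nonempty := Finset.card_pos.1 (by omega)
    obtain ⟨f, hf, b, x, hbx, hfx, huniq, hleaf⟩ := hF.exists_leaf hc hne
    let φ : V → V := fun v => if v = b ∨ ∃ e, G.Joins e b v then x else v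
    have hφ : ∀ v, (v = b ∨ ∃ e, G.Joins e b v) → φ v = x := fun v hv => if_pos hv
    have hφ' : ∀ v, ¬ (v = b ∨ ∃ e, G.Joins e b v) → φ v = v := fun v hv => if_neg hv
    set G' : WGraph V E := ⟨φ ∘ G.src, φ ∘ G.tgt, G.weight⟩ with hG'
    have hF' : G'.IsMinimumJoin (F.erase f) := hF.contract huniq hleaf hφ hφ' hfx
    have hcb : ∀ {e w}, w ≠ b → G.Joins e b w → c w = !c b := by
      intro e w hw h
      rcases h with ⟨rfl, rfl⟩ | ⟨rfl, rfl⟩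
      · have := (hc e).resolve_left hw.symm
        revert this; cases c (G.src e) <;> cases c (G.tgt e) <;> simp
      · have := (hc e).resolve_left hw
        revert this; cases c (G.src e) <;> cases c (G.tgt e) <;> simp
    have hstep : ∀ {e u v}, G.Joins e u v → ¬ (v = b ∨ ∃ e, G.Joins e b v) →
        c (φ u) = c u := by
      intro e u v h hv
      by_cases hu : u = b ∨ ∃ e, G.Joins e b u
      · rw [hφ u hu]
        rcases hu with rfl | ⟨e', he'⟩
        · exact absurd (Or.inr ⟨e, h⟩) hv
        · have hub : u ≠ b := by
            rintro rfl
            exact hv (Or.inr ⟨e, h⟩)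
          rw [hcb hub he', hcb hbx.symm hfx]
      · rw [hφ' u hu]
    have hc' : G'.IsBicoloring c := by
      intro e
      change φ (G.src e) = φ (G.tgt e) ∨ c (φ (G.src e)) ≠ c (φ (G.tgt e))
      rcases hc e with h | h
      · exact Or.inl (by rw [h])
      by_cases hs : G.src e = b ∨ ∃ e', G.Joins e' b (G.src e)
      · by_cases ht : G.tgt e = b ∨ ∃ e', G.Joins e' b (G.tgt e)
        · exact Or.inl (by rw [hφ _ hs, hφ _ ht])
        · exact Or.inr (by rwa [hstep (Or.inl ⟨rfl, rfl⟩) ht, hφ' _ ht])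
      · refine Or.inr ?_
        rwa [hφ' _ hs, hstep (Or.inr ⟨rfl, rfl⟩) hs]
    obtain ⟨U, hU₁, hU₂⟩ := ih hF' hc' (by rw [Finset.card_erase_of_mem hf, hk]; rfl)
    have hstar : ∀ {e}, G.Incident e b → ∀ W, ¬ G'.Crosses W e := by
      intro e he W h
      obtain ⟨y, hy⟩ := he.exists_joins
      apply h
      change φ (G.src e) ∈ W ↔ φ (G.tgt e) ∈ W
      rcases hy with ⟨h1, h2⟩ | ⟨h1, h2⟩
      · rw [hφ _ (Or.inl h1), hφ _ (Or.inr ⟨e, Or.inl ⟨h1, rfl⟩⟩)]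
      · rw [hφ _ (Or.inr ⟨e, Or.inr ⟨rfl, h2⟩⟩), hφ _ (Or.inl h2)]
    have hinc : ∀ {e}, G.Crosses {b} e → G.Incident e b := by
      intro e he
      by_contra h
      simp only [Incident, not_or] at h
      exact he (by simp [h.1, h.2])
    have hfb : G.Crosses {b} f := by
      rcases hfx with ⟨h1, h2⟩ | ⟨h1, h2⟩ <;> simp [Crosses, h1, h2, hbx.symm]
    refine ⟨fun g => if g = f then {b} else φ ⁻¹' U g, fun g hg h hh => ?_,
      fun g hg h hh e hge hhe => ?_⟩
    · by_cases hgf : g = f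
      · subst hgf
        simp only [if_true]
        exact ⟨fun hx => huniq h hh (hinc hx), fun hx => hx ▸ hfb⟩
      · simp only [if_neg hgf]
        by_cases hhf : h = f
        · subst hhf
          exact ⟨fun hx => absurd hx (hstar hfx.incident_left _), fun hx => absurd hx.symm hgf⟩
        · exact hU₁ g (Finset.mem_erase.2 ⟨hgf, hg⟩) h (Finset.mem_erase.2 ⟨hhf, hh⟩)
    · by_cases hgf : g = f <;> by_cases hhf : h = f
      · rw [hgf, hhf]
      · simp only [if_pos hgf, if_neg hhf] at hge hhe
        exact absurd hhe (hstar (hinc hge) _)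
      · simp only [if_neg hgf, if_pos hhf] at hge hhe
        exact absurd hge (hstar (hinc hhe) _)
      · simp only [if_neg hgf, if_neg hhf] at hge hhe
        exact hU₂ g (Finset.mem_erase.2 ⟨hgf, hg⟩) h (Finset.mem_erase.2 ⟨hhf, hh⟩) e hge hhe

end Packing

/-! ### Strong duality for uniform weights -/

section StrongDuality

variable {V E : Type} (G : WGraph V E)

/-- The graph in which every edge `e` is divided into the two halves `(e, false)` (at the source)
and `(e, true)` (at the target) by a new vertex `Sum.inr e`. -/
noncomputable def subdivide : WGraph (V ⊕ E) (E × Bool) where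
  src i := bif i.2 then Sum.inr i.1 else Sum.inl (G.src i.1)
  tgt i := bif i.2 then Sum.inl (G.tgt i.1) else Sum.inr i.1
  weight i := G.weight i.1 / 2

theorem isBicoloring_subdivide : G.subdivide.IsBicoloring Sum.isLeft := by
  rintro ⟨e, b⟩
  cases b <;> exact Or.inr (by simp [subdivide])

variable [DecidableEq V] [DecidableEq E]

theorem boundary_subdivide (N : Finset E) :
    G.subdivide.boundary (N ×ˢ Finset.univ) = Sum.elim (G.boundary N) 0 := by
  funext x
  simp only [boundary, Finset.sum_apply, Finset.sum_product, Fintype.sum_bool, subdivide,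
    Pi.add_apply, cond_true, cond_false]
  rcases x with v | e
  · simp only [Sum.elim_inl, Finset.sum_apply, Pi.add_apply]
    refine Finset.sum_congr rfl fun e _ => ?_
    simp [Pi.single_apply, add_comm]
  · simp only [Sum.elim_inr, Pi.zero_apply]
    refine Finset.sum_eq_zero fun f _ => ?_
    simp [Pi.single_apply, CharTwo.add_self_eq_zero]

/-- An edge set without boundary in the subdivided graph contains either both halves of an edge or
neither, since the two halves are the only edges at its midpoint. -/
theorem exists_of_boundary_subdivide_eq_zero {Z : Finset (E × Bool)}
    (hZ : G.subdivide.boundary Z = 0) : ∃ Z₀ : Finset E, Z = Z₀ ×ˢ Finset.univ := by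
  have h : ∀ e, (e, false) ∈ Z ↔ (e, true) ∈ Z := by
    intro e
    have h1 : G.subdivide.boundary Z (Sum.inr e) =
        ∑ i ∈ Z, ((if i = (e, false) then 1 else 0) + (if i = (e, true) then 1 else 0)) := by
      simp only [boundary, Finset.sum_apply, Pi.add_apply]
      refine Finset.sum_congr rfl fun i _ => ?_
      obtain ⟨f, b⟩ := i
      cases b <;> simp [subdivide, Pi.single_apply, eq_comm]
    rw [hZ, Finset.sum_add_distrib, Finset.sum_ite_eq', Finset.sum_ite_eq', Pi.zero_apply] at h1
    revert h1
    by_cases h2 : (e, false) ∈ Z <;> by_cases h3 : (e, true) ∈ Z <;> simp [h2, h3]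
  refine ⟨Z.image Prod.fst, ?_⟩
  ext ⟨e, b⟩
  simp only [Finset.mem_product, Finset.mem_image, Finset.mem_univ, and_true, Prod.exists,
    exists_and_right, exists_eq_right, Bool.exists_bool]
  have := h e
  cases b <;> tauto

omit [DecidableEq V] in
theorem card_symmDiff (F Z : Finset E) :
    ((symmDiff F Z).card : ℤ) = F.card + signedCard F Z := by
  have h1 : signedCard F Z = (Z \ F).card - (Z ∩ F).card := by
    have h := signedCard_union (F := F) (Finset.disjoint_sdiff_inter Z F)
    rw [Finset.sdiff_union_inter] at h
    have h2 : signedCard F (Z \ F) = (Z \ F).card := by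
      rw [signedCard, Finset.sum_congr rfl fun e he => if_neg (Finset.mem_sdiff.1 he).2]
      simp
    have h3 : signedCard F (Z ∩ F) = -(Z ∩ F).card := by
      rw [signedCard, Finset.sum_congr rfl fun e he => if_pos (Finset.mem_inter.1 he).2]
      simp
    rw [h, h2, h3]; ring
  have h2 : (symmDiff F Z).card = (F \ Z).card + (Z \ F).card :=
    Finset.card_union_of_disjoint disjoint_sdiff_sdiff
  have h3 := Finset.card_sdiff_add_card_inter F Z
  rw [Finset.inter_comm] at h3
  omega

variable {G}

theorem IsMinimumJoin.subdivide {F : Finset E} (hF : G.IsMinimumJoin F) :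
    G.subdivide.IsMinimumJoin (F ×ˢ Finset.univ) := by
  intro Z hZ
  obtain ⟨Z₀, rfl⟩ := G.exists_of_boundary_subdivide_eq_zero hZ
  rw [boundary_subdivide] at hZ
  have h := hF Z₀ (funext fun v => congrFun hZ (Sum.inl v))
  have : signedCard (F ×ˢ (Finset.univ : Finset Bool)) (Z₀ ×ˢ Finset.univ) =
      2 * signedCard F Z₀ := by
    simp only [signedCard, Finset.sum_product, Finset.mem_product, Finset.mem_univ, and_true,
      Finset.mul_sum]
    exact Finset.sum_congr rfl fun e _ => by rw [Fintype.sum_bool, two_mul]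
  rw [this]
  linarith

omit [DecidableEq E] in
/-- The handshake lemma for a vertex set and its cut. -/
theorem sum_boundary (W : Finset V) (N : Finset E) [DecidablePred (G.Crosses ↑W)] :
    ∑ v ∈ W, G.boundary N v = ((N.filter (G.Crosses ↑W)).card : ZMod 2) := by
  simp only [boundary, Finset.sum_apply, Pi.add_apply]
  rw [Finset.sum_comm, Finset.card_filter, Nat.cast_sum]
  refine Finset.sum_congr rfl fun e _ => ?_
  simp only [Finset.sum_add_distrib, Pi.single_apply, Finset.sum_ite_eq']
  by_cases h1 : G.src e ∈ W <;> by_cases h2 : G.tgt e ∈ W <;>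
    simp [Crosses, h1, h2, CharTwo.add_self_eq_zero]

open Classical in
omit [DecidableEq V] [DecidableEq E] in
/-- If every edge is cut at most twice by a family of vertex sets, a walk is at least half as long
as the number of members of the family that separate its ends. -/
theorem Walk.card_separating_le {I : Type} (A : Finset I) (U : I → Set V)
    (hU : ∀ e, (A.filter fun i => G.Crosses (U i) e).card ≤ 2) {w : ℝ} (hw0 : 0 ≤ w)
    (hw : ∀ e, G.weight e = w) {u v : V} (p : G.Walk u v) :
    (A.filter fun i => ¬ (u ∈ U i ↔ v ∈ U i)).card * (w / 2) ≤ p.length := by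
  induction p with
  | nil u => simp [Walk.length]
  | @cons u v x e h p ih =>
    have h1 : (A.filter fun i => ¬ (u ∈ U i ↔ x ∈ U i)).card ≤
        2 + (A.filter fun i => ¬ (v ∈ U i ↔ x ∈ U i)).card := by
      refine le_trans (Finset.card_le_card (t := (A.filter fun i => G.Crosses (U i) e) ∪
        (A.filter fun i => ¬ (v ∈ U i ↔ x ∈ U i))) ?_)
        ((Finset.card_union_le _ _).trans (Nat.add_le_add_right (hU e) _))
      intro i
      rw [Finset.mem_union, Finset.mem_filter, Finset.mem_filter, Finset.mem_filter, Crosses]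
      rcases h with ⟨rfl, rfl⟩ | ⟨rfl, rfl⟩ <;> tauto
    have h2 : ((A.filter fun i => ¬ (u ∈ U i ↔ x ∈ U i)).card : ℝ) ≤
        2 + ((A.filter fun i => ¬ (v ∈ U i ↔ x ∈ U i)).card : ℝ) := by exact_mod_cast h1
    rw [Walk.length, hw]
    nlinarith

theorem isMinimumJoin_of_isValid {w : ℝ} (hw0 : 0 < w) (hw : ∀ e, G.weight e = w) {T : Finset V}
    {F : Finset E} (hF : G.IsValid T F)
    (hmin : ∀ N, G.IsValid T N → G.edgeWeight F ≤ G.edgeWeight N) : G.IsMinimumJoin F := by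
  intro Z hZ
  have h1 := hmin (symmDiff F Z) (by
    rw [isValid_iff] at hF ⊢
    rwa [boundary_symmDiff, hZ, add_zero])
  simp only [edgeWeight, hw, Finset.sum_const, nsmul_eq_mul] at h1
  have h2 : F.card ≤ (symmDiff F Z).card := by exact_mod_cast le_of_mul_le_mul_right h1 hw0
  have h3 := card_symmDiff F Z
  omega

/-- Strong duality for a graph with uniform weights: the cuts that are packed in the subdivided
graph, with coefficient half the edge weight, form a dual solution with the value of the minimum
valid set. -/
theorem exists_dual_eq_edgeWeight [Fintype V] [Fintype E] {w : ℝ≥0} (hw0 : 0 < w)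
    (hw : ∀ e, G.weight e = w) {T : Finset V} {F : Finset E} (hF : G.IsValid T F)
    (hmin : ∀ N, G.IsValid T N → G.edgeWeight F ≤ G.edgeWeight N) :
    ∃ y, IsDualFeasible G T y ∧ (dualObjective T y : ℝ) = G.edgeWeight F := by
  classical
  have hJ := isMinimumJoin_of_isValid (NNReal.coe_pos.2 hw0) hw hF hmin
  obtain ⟨U, hU₁, hU₂⟩ := hJ.subdivide.exists_cuts G.isBicoloring_subdivide
  set A : Finset (E × Bool) := F ×ˢ Finset.univ with hA
  let S : E × Bool → Finset V := fun i => T.filter fun v => Sum.inl v ∈ U i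
  have hSodd : ∀ i ∈ A, S i ∈ oddSubsets T := by
    intro i hi
    refine Finset.mem_filter.2 ⟨Finset.mem_powerset.2 (Finset.filter_subset _ _), ?_⟩
    have h1 := G.subdivide.sum_boundary (Finset.univ.filter (· ∈ U i)) A
    have h2 : (A.filter (G.subdivide.Crosses ↑(Finset.univ.filter (· ∈ U i)))) = {i} := by
      ext g
      simp only [Finset.coe_filter, Finset.mem_univ, true_and, Set.ofPred_mem_eq,
        Finset.mem_filter, Finset.mem_singleton]
      exact ⟨fun h => (hU₁ i hi g h.1).1 h.2, fun h => by rw [h]; exact ⟨hi, (hU₁ i hi i hi).2 rfl⟩⟩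
    rw [h2, boundary_subdivide, Finset.sum_filter, Fintype.sum_sum_type] at h1
    simp only [Sum.elim_inl, Sum.elim_inr, Pi.zero_apply, ite_self, Finset.sum_const_zero,
      add_zero, Finset.card_singleton, Nat.cast_one, G.isValid_iff.1 hF] at h1
    rw [← ZMod.natCast_eq_one_iff_odd, ← h1, Finset.card_filter, Nat.cast_sum]
    rw [← Finset.sum_subset (Finset.subset_univ T)]
    · refine Finset.sum_congr rfl fun v hv => ?_
      simp [hv]
    · intro v _ hv
      simp [hv]
  have hcut : ∀ e, (A.filter fun i => G.Crosses (Sum.inl ⁻¹' U i) e).card ≤ 2 := by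
    intro e
    have hone : ∀ j, (A.filter fun i => G.subdivide.Crosses (U i) j).card ≤ 1 := by
      intro j
      refine Finset.card_le_one.2 fun a ha b hb => ?_
      rw [Finset.mem_filter] at ha hb
      exact hU₂ a ha.1 b hb.1 j ha.2 hb.2
    refine le_trans (Finset.card_le_card
      (t := (A.filter fun i => G.subdivide.Crosses (U i) (e, false)) ∪
        (A.filter fun i => G.subdivide.Crosses (U i) (e, true))) ?_)
      ((Finset.card_union_le _ _).trans (Nat.add_le_add (hone _) (hone _)))
    intro i
    rw [Finset.mem_union, Finset.mem_filter, Finset.mem_filter, Finset.mem_filter]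
    simp only [Crosses, subdivide, cond_true, cond_false, Set.mem_preimage]
    tauto
  refine ⟨fun R => ∑ i ∈ A, if S i = R then w / 2 else 0, ?_, ?_⟩
  · intro u hu v hv _
    refine le_iInf fun p => ?_
    have h1 := p.card_separating_le A (fun i => Sum.inl ⁻¹' U i) hcut w.2 hw
    rw [← ENNReal.ofReal_coe_nnreal]
    refine ENNReal.ofReal_le_ofReal (le_trans ?_ h1)
    have h2 : (∑ R ∈ delta T u v, ∑ i ∈ A, if S i = R then w / 2 else 0) =
        (A.filter fun i => S i ∈ delta T u v).card * (w / 2) := by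
      rw [Finset.sum_comm]
      simp only [Finset.sum_ite_eq]
      rw [← Finset.sum_filter, Finset.sum_const, nsmul_eq_mul]
    rw [h2]
    push_cast
    refine mul_le_mul_of_nonneg_right ?_ (by positivity)
    refine Nat.cast_le.2 (Finset.card_le_card fun i => ?_)
    simp only [Finset.mem_filter, delta, S, hu, hv, true_and, Set.mem_preimage]
    tauto
  · have h1 : (∑ R ∈ oddSubsets T, ∑ i ∈ A, if S i = R then w / 2 else 0) = F.card * w := by
      rw [Finset.sum_comm]
      simp only [Finset.sum_ite_eq]
      rw [Finset.sum_congr rfl fun i hi => if_pos (hSodd i hi), Finset.sum_const, nsmul_eq_mul, hA,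
        Finset.card_product, Finset.card_univ, Fintype.card_bool]
      push_cast
      rw [mul_assoc, mul_div_cancel₀ _ two_ne_zero]
    rw [dualObjective, h1]
    simp [edgeWeight, hw]

end StrongDuality

/-! ### Weak duality with a covered length -/

section WeakDuality

variable {V E : Type} (G : WGraph V E)

/-- For `d ≥ 0`: the length of the part of the edge `e` that lies, measured along `e`, within
distance `d (src e)` of its source or `d (tgt e)` of its target. -/
noncomputable def coveredLength (d : V → ℝ) (e : E) : ℝ :=
  min (G.weight e) (d (G.src e) + d (G.tgt e))

/-- The depth `d x` of a vertex in a union of balls of radii `r v`: the largest radius of a ball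
about `x` that the triangle inequality shows to be contained in one of them. -/
theorem exists_depth [Finite V] (hw : ∀ e, 0 ≤ G.weight e) (r : V → ℝ≥0) :
    ∃ d : V → ℝ, (∀ v, r v ≤ d v) ∧ (∀ e u v, G.Joins e u v → d u ≤ d v + G.weight e) ∧
      ∀ x, ∃ v, G.pairWeight x v + ENNReal.ofReal (d x) ≤ r v := by
  have hself : ∀ x, G.pairWeight x x = 0 := fun x =>
    le_antisymm (iInf_le_of_le (.nil x) (by simp [Walk.length])) (zero_le)
  let D : V → ℝ≥0∞ := fun x => ⨆ v, ((r v : ℝ≥0∞) - G.pairWeight x v)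
  have hmax : ∀ x, ∃ v, (r v : ℝ≥0∞) - G.pairWeight x v = D x := fun x =>
    haveI : Nonempty V := ⟨x⟩
    exists_eq_ciSup_of_finite
  have hfin : ∀ x, D x ≠ ∞ := by
    intro x
    obtain ⟨v, hv⟩ := hmax x
    rw [← hv]
    exact ne_top_of_le_ne_top ENNReal.coe_ne_top tsub_le_self
  refine ⟨fun x => (D x).toReal, fun v => ?_, fun e u v h => ?_, fun x => ?_⟩
  · have h1 : (r v : ℝ≥0∞) ≤ D v := by
      have := le_iSup (fun z => (r z : ℝ≥0∞) - G.pairWeight v z) v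
      simpa [hself] using this
    simpa using ENNReal.toReal_mono (hfin v) h1
  · have h1 : D u ≤ D v + ENNReal.ofReal (G.weight e) := by
      refine iSup_le fun z => ?_
      have h2 : G.pairWeight v z ≤ ENNReal.ofReal (G.weight e) + G.pairWeight u z := by
        unfold pairWeight
        rw [ENNReal.add_iInf]
        refine le_iInf fun p => (iInf_le _ (.cons e h.symm p)).trans ?_
        exact ENNReal.ofReal_add_le
      refine tsub_le_iff_right.2 ?_
      have h3 : (r z : ℝ≥0∞) ≤ D v + G.pairWeight v z :=
        tsub_le_iff_right.1 (le_iSup (fun z => (r z : ℝ≥0∞) - G.pairWeight v z) z)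
      refine h3.trans ?_
      rw [add_assoc]
      exact add_le_add le_rfl h2
    have h2 := ENNReal.toReal_mono (by simp [hfin]) h1
    rwa [ENNReal.toReal_add (hfin v) ENNReal.ofReal_ne_top, ENNReal.toReal_ofReal (hw e)] at h2
  · rw [ENNReal.ofReal_toReal (hfin x)]
    obtain ⟨v, hv⟩ := hmax x
    rcases le_total (G.pairWeight x v) (r v) with h | h
    · exact ⟨v, by rw [← hv, add_tsub_cancel_of_le h]⟩
    · refine ⟨x, ?_⟩
      rw [← hv, tsub_eq_zero_of_le h, hself]
      simp

variable {G}

theorem coveredLength_nonneg {d : V → ℝ} (hd : ∀ v, 0 ≤ d v) (hw : ∀ e, 0 ≤ G.weight e) (e : E) :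
    0 ≤ G.coveredLength d e := le_min (hw e) (add_nonneg (hd _) (hd _))

theorem edgeWeight_nonneg (hw : ∀ e, 0 ≤ G.weight e) (N : Finset E) : 0 ≤ G.edgeWeight N :=
  Finset.sum_nonneg fun e _ => hw e

variable [DecidableEq E]

theorem Trail.le_add_edgeWeight {d : V → ℝ}
    (hlip : ∀ e u v, G.Joins e u v → d u ≤ d v + G.weight e)
    {u v : V} {N : Finset E} (p : G.Trail u v N) : d v ≤ d u + G.edgeWeight N := by
  induction p with
  | nil u => simp [edgeWeight]
  | @cons u v w e N h he p ih =>
    rw [edgeWeight] at ih ⊢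
    rw [Finset.sum_insert he]
    have := hlip e v u h.symm
    linarith

/-- A trail is covered near its ends, up to the depths of the two ends. -/
theorem Trail.min_le_sum_coveredLength {d : V → ℝ} (hd : ∀ v, 0 ≤ d v)
    (hlip : ∀ e u v, G.Joins e u v → d u ≤ d v + G.weight e)
    {u v : V} {N : Finset E} (p : G.Trail u v N) :
    min (G.edgeWeight N) (d u + d v) ≤ ∑ e ∈ N, G.coveredLength d e := by
  induction p with
  | nil u => simp [edgeWeight]
  | @cons u v w e N h he p ih =>
    have h1 := p.le_add_edgeWeight hlip
    have h2 := hlip e u v h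
    have h3 : G.coveredLength d e = min (G.weight e) (d u + d v) := by
      rcases h with ⟨rfl, rfl⟩ | ⟨rfl, rfl⟩
      · rfl
      · rw [coveredLength, add_comm]
    rw [edgeWeight] at ih h1 ⊢
    rw [Finset.sum_insert he, Finset.sum_insert he, h3]
    have := hd v
    rcases min_cases (G.weight e) (d u + d v) with ⟨h4, h5⟩ | ⟨h4, h5⟩ <;>
    rcases min_cases (∑ e ∈ N, G.weight e) (d v + d w) with ⟨h6, h7⟩ | ⟨h6, h7⟩ <;>
    rw [h4] <;> rw [h6] at ih <;> rw [min_le_iff]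
    · exact Or.inl (by linarith)
    · exact Or.inr (by linarith)
    · exact Or.inr (by linarith)
    · exact Or.inr (by linarith)

variable [DecidableEq V]

/-- The dual weight that separates the ends of a trail is bounded by the length of the trail, by
feasibility, and by the sum of the two radii, since a separating set contains one of the ends. -/
theorem sum_delta_le_min {T : Finset V} {y : Finset V → ℝ≥0} (hy : IsDualFeasible G T y)
    (hw : ∀ e, 0 ≤ G.weight e) {u v : V} (hu : u ∈ T) (hv : v ∈ T) (huv : u ≠ v) {Q : Finset E}
    (p : G.Trail u v Q) :
    ((∑ S ∈ delta T u v, y S : ℝ≥0) : ℝ) ≤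
      min (G.edgeWeight Q) (dualRadius T y u + dualRadius T y v) := by
  refine le_min ?_ ?_
  · obtain ⟨q, hq⟩ := p.exists_walk
    have h := (hy u hu v hv huv).trans (iInf_le _ q)
    rw [hq, ← ENNReal.ofReal_coe_nnreal] at h
    exact (ENNReal.ofReal_le_ofReal_iff (edgeWeight_nonneg hw Q)).1 h
  · rw [← NNReal.coe_add, NNReal.coe_le_coe, delta, dualRadius, dualRadius, Finset.sum_filter,
      Finset.sum_filter, Finset.sum_filter, ← Finset.sum_add_distrib]
    refine Finset.sum_le_sum fun S _ => ?_
    by_cases h1 : u ∈ S <;> by_cases h2 : v ∈ S <;> simp [h1, h2]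

/-- The odd sets that meet the boundary of `N` an odd number of times have total dual weight at most
the covered length of `N`: trails between vertices of odd degree are split off one at a time. -/
theorem sum_dual_le_sum_coveredLength {T : Finset V} {y : Finset V → ℝ≥0}
    (hy : IsDualFeasible G T y) (hw : ∀ e, 0 ≤ G.weight e) {d : V → ℝ}
    (hr : ∀ v, dualRadius T y v ≤ d v)
    (hlip : ∀ e u v, G.Joins e u v → d u ≤ d v + G.weight e) (N : Finset E)
    (hN : ∀ v, G.boundary N v ≠ 0 → v ∈ T) :
    ((∑ S ∈ (oddSubsets T).filter (fun S => ∑ v ∈ S, G.boundary N v ≠ 0), y S : ℝ≥0) : ℝ) ≤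
      ∑ e ∈ N, G.coveredLength d e := by
  have hd : ∀ v, 0 ≤ d v := fun v => (NNReal.coe_nonneg _).trans (hr v)
  induction hk : N.card using Nat.strong_induction_on generalizing N with
  | _ k ih =>
    by_cases h0 : G.boundary N = 0
    · simp only [h0, Pi.zero_apply, Finset.sum_const_zero, ne_eq, not_true_eq_false,
        Finset.filter_false, Finset.sum_empty, NNReal.coe_zero]
      exact Finset.sum_nonneg fun e _ => coveredLength_nonneg hd hw e
    obtain ⟨u, hu⟩ := Function.ne_iff.1 h0
    obtain ⟨v, Q, hvu, hv, hQ, q, -⟩ := exists_trail_of_boundary_ne_zero hu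
    have hb : G.boundary (N \ Q) = G.boundary N + (Pi.single u 1 + Pi.single v 1) := by
      rw [G.boundary_sdiff hQ, q.boundary_eq]
    have hQne : Q.Nonempty := by
      rw [Finset.nonempty_iff_ne_empty]
      rintro rfl
      exact hvu q.eq_of_empty.symm
    have hlt : (N \ Q).card < k := hk ▸ Finset.card_lt_card (Finset.sdiff_ssubset hQ hQne)
    have h1 := ih _ hlt (N \ Q) (by
      intro x hx
      by_cases hxu : x = u
      · exact hxu ▸ hN u hu
      by_cases hxv : x = v
      · exact hxv ▸ hN v hv
      apply hN
      simpa [hb, hxu, hxv] using hx) rfl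
    have h2 := (sum_delta_le_min hy hw (hN u hu) (hN v hv) hvu.symm q).trans
      ((min_le_min_left _ (add_le_add (hr u) (hr v))).trans
        (q.min_le_sum_coveredLength hd hlip))
    rw [← Finset.sum_sdiff hQ]
    refine le_trans ?_ (add_le_add h1 h2)
    rw [← NNReal.coe_add, NNReal.coe_le_coe, delta, Finset.sum_filter, Finset.sum_filter,
      Finset.sum_filter, ← Finset.sum_add_distrib]
    refine Finset.sum_le_sum fun S _ => ?_
    have h3 : ∑ x ∈ S, G.boundary (N \ Q) x = ∑ x ∈ S, G.boundary N x +
        ((if u ∈ S then 1 else 0) + (if v ∈ S then 1 else 0)) := by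
      simp only [hb, Pi.add_apply, Finset.sum_add_distrib, Pi.single_apply, Finset.sum_ite_eq']
    rw [h3]
    by_cases hs : ∑ x ∈ S, G.boundary N x = 0
    · simp [hs]
    · by_cases h4 : u ∈ S <;> by_cases h5 : v ∈ S <;>
        simp [h4, h5, hs, CharTwo.add_self_eq_zero]

/-- Weak duality: already the covered part of a valid edge set is at least as long as the dual
objective. -/
theorem dualObjective_le_sum_coveredLength {T : Finset V} {y : Finset V → ℝ≥0}
    (hy : IsDualFeasible G T y) (hw : ∀ e, 0 ≤ G.weight e) {d : V → ℝ}
    (hr : ∀ v, dualRadius T y v ≤ d v)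
    (hlip : ∀ e u v, G.Joins e u v → d u ≤ d v + G.weight e) {N : Finset E} (hN : G.IsValid T N) :
    (dualObjective T y : ℝ) ≤ ∑ e ∈ N, G.coveredLength d e := by
  rw [isValid_iff] at hN
  have h := sum_dual_le_sum_coveredLength hy hw hr hlip N fun v hv => by
    by_contra hvT
    simp [hN, hvT] at hv
  rw [Finset.filter_true_of_mem] at h
  · exact h
  · intro S hS
    obtain ⟨h1, h2⟩ := Finset.mem_filter.1 hS
    have h3 : ∑ v ∈ S, G.boundary N v = S.card := by
      rw [Finset.card_eq_sum_ones, Nat.cast_sum]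
      refine Finset.sum_congr rfl fun v hv => ?_
      rw [hN, if_pos (Finset.mem_powerset.1 h1 hv), Nat.cast_one]
    rw [h3, ZMod.natCast_eq_one_iff_odd.2 h2]
    exact one_ne_zero

end WeakDuality

end WGraph

/-! ### Upper bounds for glued distances -/

theorem glueEDist_le_dist {P : Type} (d : P → P → ℝ≥0∞) (R : P → P → Prop) (x y : P) :
    glueEDist d R x y ≤ d x y := by
  refine (glueEDist_le 1 (fun i => if i = 0 then x else y) rfl rfl).trans ?_
  have h : stepCost d R x y ≤ d x y := by
    unfold stepCost
    split_ifs
    · exact zero_le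
    · exact le_rfl
  simpa using h

theorem glueEDist_eq_zero {P : Type} {d : P → P → ℝ≥0∞} {R : P → P → Prop} {x y : P} (h : R x y) :
    glueEDist d R x y = 0 := by
  refine le_antisymm ((glueEDist_le 1 (fun i => if i = 0 then x else y) rfl rfl).trans ?_)
    (zero_le)
  simp [stepCost, h]

namespace Point

variable {V E : Type} {G : WGraph V E}

theorem edist_edge_edge_le (e : E) (s t : Set.Icc (0 : ℝ) (G.weight e)) :
    edist (Point.edge e s : Point G) (Point.edge e t) ≤ ENNReal.ofReal |s.1 - t.1| := by
  refine (glueEDist_le_dist unionDist Endpoint _ _).trans ?_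
  simp [unionDist]

theorem edist_edge_src_eq_zero {e : E} {t : Set.Icc (0 : ℝ) (G.weight e)} (ht : t.1 = 0) :
    edist (Point.edge e t : Point G) (Point.vertex (G.src e)) = 0 :=
  glueEDist_eq_zero (Or.inl ⟨ht, rfl⟩)

theorem edist_edge_tgt_eq_zero {e : E} {t : Set.Icc (0 : ℝ) (G.weight e)}
    (ht : t.1 = G.weight e) :
    edist (Point.edge e t : Point G) (Point.vertex (G.tgt e)) = 0 :=
  glueEDist_eq_zero (Or.inr ⟨ht, rfl⟩)

theorem edist_edge_src_le (e : E) (t : Set.Icc (0 : ℝ) (G.weight e)) :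
    edist (Point.edge e t : Point G) (Point.vertex (G.src e)) ≤ ENNReal.ofReal t.1 := by
  have h0 : (0 : ℝ) ∈ Set.Icc (0 : ℝ) (G.weight e) := ⟨le_rfl, t.2.1.trans t.2.2⟩
  refine (edist_triangle _ (Point.edge e ⟨0, h0⟩) _).trans ?_
  rw [edist_edge_src_eq_zero rfl, add_zero]
  refine (edist_edge_edge_le e _ _).trans ?_
  simp [abs_of_nonneg t.2.1]

theorem edist_edge_tgt_le (e : E) (t : Set.Icc (0 : ℝ) (G.weight e)) :
    edist (Point.edge e t : Point G) (Point.vertex (G.tgt e)) ≤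
      ENNReal.ofReal (G.weight e - t.1) := by
  have h0 : G.weight e ∈ Set.Icc (0 : ℝ) (G.weight e) := ⟨t.2.1.trans t.2.2, le_rfl⟩
  refine (edist_triangle _ (Point.edge e ⟨_, h0⟩) _).trans ?_
  rw [edist_edge_tgt_eq_zero rfl, add_zero]
  refine (edist_edge_edge_le e _ _).trans ?_
  rw [abs_sub_comm, abs_of_nonneg (sub_nonneg.2 t.2.2)]

theorem edist_vertex_le_of_joins (hw : ∀ e, 0 ≤ G.weight e) {e : E} {u v : V}
    (h : G.Joins e u v) :
    edist (Point.vertex u : Point G) (Point.vertex v) ≤ ENNReal.ofReal (G.weight e) := by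
  have h0 : (0 : ℝ) ∈ Set.Icc (0 : ℝ) (G.weight e) := ⟨le_rfl, hw e⟩
  have h1 : edist (Point.vertex (G.src e) : Point G) (Point.vertex (G.tgt e)) ≤
      ENNReal.ofReal (G.weight e) := by
    refine (edist_triangle_left _ _ (Point.edge e ⟨0, h0⟩)).trans ?_
    rw [edist_edge_src_eq_zero rfl, zero_add]
    simpa using edist_edge_tgt_le e ⟨0, h0⟩
  rcases h with ⟨rfl, rfl⟩ | ⟨rfl, rfl⟩
  · exact h1
  · rwa [edist_comm]

theorem edist_vertex_le_pairWeight (hw : ∀ e, 0 ≤ G.weight e) (u v : V) :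
    edist (Point.vertex u : Point G) (Point.vertex v) ≤ G.pairWeight u v := by
  refine le_iInf fun p => ?_
  suffices h : 0 ≤ p.length ∧ edist (Point.vertex u : Point G) (Point.vertex v) ≤
      ENNReal.ofReal p.length from h.2
  induction p with
  | nil u => simp [WGraph.Walk.length]
  | @cons u v w e h p ih =>
    refine ⟨add_nonneg (hw e) ih.1, ?_⟩
    rw [WGraph.Walk.length, ENNReal.ofReal_add (hw e) ih.1]
    exact (edist_triangle _ _ _).trans (add_le_add (edist_vertex_le_of_joins hw h) ih.2)

end Point

/-! ### The part of an edge inside the clusters -/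

section Inside

variable {V E : Type} {G : WGraph V E}

theorem mem_clusterSet_of_edist_le (hw : ∀ e, 0 ≤ G.weight e) {r : V → ℝ≥0} {d : V → ℝ}
    (hball : ∀ x, ∃ v, G.pairWeight x v + ENNReal.ofReal (d x) ≤ r v) {z : Point G} {x : V}
    (hz : edist z (Point.vertex x) ≤ ENNReal.ofReal (d x)) : z ∈ clusterSet G r := by
  obtain ⟨v, hv⟩ := hball x
  refine Set.mem_iUnion.2 ⟨v, ?_⟩
  rw [Metric.mem_closedEBall]
  refine (edist_triangle _ (Point.vertex x) _).trans (le_trans ?_ hv)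
  rw [add_comm]
  exact add_le_add (Point.edist_vertex_le_pairWeight hw x v) hz

variable {C : Set (Point G)} {d : V → ℝ}

/-- The covered part of an edge lies in `C`, where `C` contains the ball of radius `d x` about every
vertex `x`. -/
theorem coveredLength_le_volume (hd : ∀ v, 0 ≤ d v)
    (hC : ∀ z x, edist z (Point.vertex x) ≤ ENNReal.ofReal (d x) → z ∈ C) (e : E)
    (hw : 0 ≤ G.weight e) :
    G.coveredLength d e ≤ MeasureTheory.volume.real
      {t : ℝ | ∃ h : t ∈ Set.Icc (0 : ℝ) (G.weight e), Point.edge e ⟨t, h⟩ ∈ C} := by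
  set A := {t : ℝ | ∃ h : t ∈ Set.Icc (0 : ℝ) (G.weight e), Point.edge e ⟨t, h⟩ ∈ C} with hA
  have hAfin : MeasureTheory.volume A ≠ ∞ :=
    ne_top_of_le_ne_top (by simp) (MeasureTheory.measure_mono
      (show A ⊆ Set.Icc 0 (G.weight e) from fun t ht => ht.1))
  have h1 : ∀ t ∈ Set.Icc (0 : ℝ) (G.weight e), t ≤ d (G.src e) → t ∈ A := fun t ht h =>
    ⟨ht, hC _ _ ((Point.edist_edge_src_le e ⟨t, ht⟩).trans (ENNReal.ofReal_le_ofReal h))⟩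
  have h2 : ∀ t ∈ Set.Icc (0 : ℝ) (G.weight e), G.weight e - t ≤ d (G.tgt e) → t ∈ A :=
    fun t ht h =>
      ⟨ht, hC _ _ ((Point.edist_edge_tgt_le e ⟨t, ht⟩).trans (ENNReal.ofReal_le_ofReal h))⟩
  have hs := hd (G.src e)
  have ht := hd (G.tgt e)
  rw [WGraph.coveredLength]
  rcases le_total (G.weight e) (d (G.src e) + d (G.tgt e)) with h | h
  · rw [min_eq_left h]
    have : Set.Icc 0 (G.weight e) ⊆ A := by
      intro t ht
      rcases le_total t (d (G.src e)) with h3 | h3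
      · exact h1 t ht h3
      · exact h2 t ht (by linarith)
    have h3 := MeasureTheory.measureReal_mono this hAfin
    rwa [Real.volume_real_Icc_of_le hw, sub_zero] at h3
  · rw [min_eq_right h]
    have hsub : Set.Icc 0 (d (G.src e)) ∪ Set.Ioc (G.weight e - d (G.tgt e)) (G.weight e) ⊆ A := by
      rintro t (⟨h3, h4⟩ | ⟨h3, h4⟩)
      · exact h1 t ⟨h3, by linarith⟩ h4
      · exact h2 t ⟨by linarith, h4⟩ (by linarith)
    have hdis : Disjoint (Set.Icc 0 (d (G.src e)))
        (Set.Ioc (G.weight e - d (G.tgt e)) (G.weight e)) :=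
      Set.disjoint_left.2 fun t h3 h4 => by linarith [h3.2, h4.1]
    have h3 := MeasureTheory.measureReal_mono hsub hAfin
    rw [MeasureTheory.measureReal_union hdis measurableSet_Ioc measure_Icc_lt_top.ne
      measure_Ioc_lt_top.ne, Real.volume_real_Icc_of_le hs,
      Real.volume_real_Ioc_of_le (by linarith)] at h3
    linarith

end Inside

/-! ### Paths in the contracted space -/

section Paths

variable {V E : Type} {G : WGraph V E} {C : Set (Point G)} {d : V → ℝ}

theorem edist_toContracted_le (x y : Point G) :
    edist (toContracted C x) (toContracted C y) ≤ edist x y :=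
  glueEDist_le_dist (P := Point G) (fun x y => edist x y) (SameComponent C) x y

theorem edist_toContracted_eq_zero {x y : Point G} (h : SameComponent C x y) :
    edist (toContracted C x) (toContracted C y) = 0 :=
  glueEDist_eq_zero (P := Point G) (d := fun x y => edist x y) h

/-- The point at distance `t` from the source on the edge `e`, as a function on the real line that
is constant outside `[0, weight e]`. -/
noncomputable def edgePath (e : E) (hw : 0 ≤ G.weight e) (t : ℝ) : Point G :=
  Point.edge e (Set.projIcc 0 (G.weight e) hw t)

theorem lipschitzWith_edgePath (e : E) (hw : 0 ≤ G.weight e) :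
    LipschitzWith 1 (edgePath e hw) := by
  intro s t
  refine (Point.edist_edge_edge_le e _ _).trans ?_
  have h := LipschitzWith.projIcc hw s t
  rwa [Subtype.edist_eq, edist_dist, Real.dist_eq] at h

theorem edgePath_of_mem {e : E} (hw : 0 ≤ G.weight e) {t : ℝ} (ht : t ∈ Set.Icc 0 (G.weight e)) :
    edgePath e hw t = Point.edge e ⟨t, ht⟩ := by
  rw [edgePath, Set.projIcc_of_mem hw ht]

/-- A subinterval of an edge that lies in `C` has length `0` in the contracted space. -/
theorem eVariationOn_edgePath_eq_zero {e : E} (hw : 0 ≤ G.weight e) {a b : ℝ}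
    (h : ∀ t ∈ Set.Icc a b, edgePath e hw t ∈ C) :
    eVariationOn (fun t => toContracted C (edgePath e hw t)) (Set.Icc a b) = 0 := by
  rw [eVariationOn.eq_zero_iff]
  intro s hs t ht
  refine edist_toContracted_eq_zero ⟨h s hs, ?_⟩
  have hpre : IsPreconnected (edgePath e hw '' Set.Icc a b) :=
    isPreconnected_Icc.image _ (lipschitzWith_edgePath e hw).continuous.continuousOn
  exact hpre.subset_connectedComponentIn (Set.mem_image_of_mem _ hs)
    (Set.image_subset_iff.2 h) (Set.mem_image_of_mem _ ht)

theorem eVariationOn_le_of_lipschitzWith {X : Type} [PseudoEMetricSpace X] {f : ℝ → X}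
    (hf : LipschitzWith 1 f) {a b : ℝ} (hab : a ≤ b) :
    eVariationOn f (Set.Icc a b) ≤ ENNReal.ofReal (b - a) := by
  have h1 := (hf.lipschitzOnWith (s := Set.univ)).comp_eVariationOn_le (g := (id : ℝ → ℝ))
    (s := Set.Icc a b) (fun _ _ => Set.mem_univ _)
  rw [ENNReal.coe_one, one_mul] at h1
  refine h1.trans ?_
  have h2 := (MonotoneOn.eVariationOn_eq (f := (id : ℝ → ℝ)) (s := Set.Icc a b)
    (monotone_id.monotoneOn _) (Set.left_mem_Icc.2 hab) (Set.right_mem_Icc.2 hab)).le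
  rwa [Set.inter_self] at h2

theorem lipschitzWith_toContracted_edgePath (e : E) (hw : 0 ≤ G.weight e) :
    LipschitzWith 1 fun t => toContracted C (edgePath e hw t) := fun s t =>
  (edist_toContracted_le _ _).trans (lipschitzWith_edgePath e hw s t)

/-- The image of an edge in the contracted space is no longer than its uncovered length: the two
ends within the covering balls are contracted, and the middle part keeps its length. -/
theorem eVariationOn_edgePath_le (hd : ∀ v, 0 ≤ d v)
    (hC : ∀ z x, edist z (Point.vertex x) ≤ ENNReal.ofReal (d x) → z ∈ C) (e : E)
    (hw : 0 ≤ G.weight e) :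
    eVariationOn (fun t => toContracted C (edgePath e hw t)) (Set.Icc 0 (G.weight e)) ≤
      ENNReal.ofReal (G.weight e - G.coveredLength d e) := by
  have h1 : ∀ t ∈ Set.Icc (0 : ℝ) (G.weight e), t ≤ d (G.src e) → edgePath e hw t ∈ C := by
    intro t ht h
    rw [edgePath_of_mem hw ht]
    exact hC _ _ ((Point.edist_edge_src_le e ⟨t, ht⟩).trans (ENNReal.ofReal_le_ofReal h))
  have h2 : ∀ t ∈ Set.Icc (0 : ℝ) (G.weight e), G.weight e - t ≤ d (G.tgt e) →
      edgePath e hw t ∈ C := by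
    intro t ht h
    rw [edgePath_of_mem hw ht]
    exact hC _ _ ((Point.edist_edge_tgt_le e ⟨t, ht⟩).trans (ENNReal.ofReal_le_ofReal h))
  have hs := hd (G.src e)
  have ht := hd (G.tgt e)
  rw [WGraph.coveredLength]
  rcases le_total (G.weight e) (d (G.src e) + d (G.tgt e)) with h | h
  · rw [eVariationOn_edgePath_eq_zero hw]
    · exact zero_le
    · intro t ht
      rcases le_total t (d (G.src e)) with h3 | h3
      · exact h1 t ht h3
      · exact h2 t ht (by linarith)
  · rw [min_eq_right h]
    have hadd := fun a b c hab hbc => eVariationOn.Icc_add_Icc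
      (fun t => toContracted C (edgePath e hw t)) (s := Set.univ) (a := a) (b := b) (c := c)
      hab hbc (Set.mem_univ b)
    simp only [Set.univ_inter] at hadd
    rw [← hadd 0 (d (G.src e)) _ hs (by linarith),
      ← hadd (d (G.src e)) (G.weight e - d (G.tgt e)) _ (by linarith) (by linarith),
      eVariationOn_edgePath_eq_zero hw (fun t ht => h1 t ⟨ht.1, by linarith [ht.2]⟩ ht.2),
      eVariationOn_edgePath_eq_zero hw (a := G.weight e - d (G.tgt e))
        (fun t ht => h2 t ⟨by linarith [ht.1], ht.2⟩ (by linarith [ht.1])), zero_add, add_zero]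
    refine (eVariationOn_le_of_lipschitzWith (lipschitzWith_toContracted_edgePath e hw)
      (by linarith)).trans (ENNReal.ofReal_le_ofReal (by linarith))

/-- An edge can be traversed in either direction at the cost of its uncovered length. -/
theorem exists_path_of_joins (hd : ∀ v, 0 ≤ d v)
    (hC : ∀ z x, edist z (Point.vertex x) ≤ ENNReal.ofReal (d x) → z ∈ C) {e : E} {u v : V}
    (hw : 0 ≤ G.weight e) (h : G.Joins e u v) :
    ∃ γ : ℝ → Contracted C, LipschitzWith 1 γ ∧
      edist (γ 0) (toContracted C (Point.vertex u)) = 0 ∧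
      edist (γ (G.weight e)) (toContracted C (Point.vertex v)) = 0 ∧
      Covers γ (G.weight e) {e} ∧
      eVariationOn γ (Set.Icc 0 (G.weight e)) ≤
        ENNReal.ofReal (G.weight e - G.coveredLength d e) := by
  have h0 : (0 : ℝ) ∈ Set.Icc 0 (G.weight e) := Set.left_mem_Icc.2 hw
  have h1 : G.weight e ∈ Set.Icc 0 (G.weight e) := Set.right_mem_Icc.2 hw
  have hsrc : edist (toContracted C (edgePath e hw 0)) (toContracted C (Point.vertex (G.src e))) =
      0 := by
    refine le_antisymm ((edist_toContracted_le _ _).trans ?_) (zero_le)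
    rw [edgePath_of_mem hw h0, Point.edist_edge_src_eq_zero rfl]
  have htgt : edist (toContracted C (edgePath e hw (G.weight e)))
      (toContracted C (Point.vertex (G.tgt e))) = 0 := by
    refine le_antisymm ((edist_toContracted_le _ _).trans ?_) (zero_le)
    rw [edgePath_of_mem hw h1, Point.edist_edge_tgt_eq_zero rfl]
  have hlip := lipschitzWith_toContracted_edgePath (C := C) e hw
  have hvar := eVariationOn_edgePath_le hd hC e hw
  rcases h with ⟨rfl, rfl⟩ | ⟨rfl, rfl⟩
  · refine ⟨_, hlip, hsrc, htgt, ?_, hvar⟩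
    simp only [Covers, Finset.mem_singleton, forall_eq]
    intro t
    exact ⟨t, t.2, by rw [edgePath_of_mem hw t.2, edist_self]⟩
  · have hrev : LipschitzWith 1 fun t : ℝ => G.weight e - t := by
      simpa using (LipschitzWith.const (G.weight e)).sub LipschitzWith.id
    refine ⟨fun t => toContracted C (edgePath e hw (G.weight e - t)),
      by simpa [Function.comp_def] using hlip.comp hrev, by simpa using htgt,
      by simpa using hsrc, ?_, ?_⟩
    · simp only [Covers, Finset.mem_singleton, forall_eq]
      intro t
      refine ⟨G.weight e - t, ⟨by linarith [t.2.2], by linarith [t.2.1]⟩, ?_⟩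
      rw [sub_sub_cancel, edgePath_of_mem hw t.2, edist_self]
    · refine le_trans (eVariationOn.comp_le_of_antitoneOn
        (fun t => toContracted C (edgePath e hw t)) (s := Set.Icc 0 (G.weight e))
        (fun t => G.weight e - t) ?_ ?_) hvar
      · exact fun a _ b _ hab => sub_le_sub_left hab _
      · exact fun t ht => ⟨by linarith [ht.2], by linarith [ht.1]⟩

/-- Concatenation of paths whose ends have distance `0`. -/
theorem exists_concat {X : Type} [PseudoEMetricSpace X] {α β : ℝ → X} {a b : ℝ} (ha : 0 ≤ a)
    (hb : 0 ≤ b) (hα : LipschitzOnWith 1 α (Set.Icc 0 a)) (hβ : LipschitzOnWith 1 β (Set.Icc 0 b))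
    (h : edist (α a) (β 0) = 0) :
    ∃ γ : ℝ → X, LipschitzOnWith 1 γ (Set.Icc 0 (a + b)) ∧ (∀ t ∈ Set.Icc 0 a, γ t = α t) ∧
      (∀ t ∈ Set.Icc 0 b, edist (γ (a + t)) (β t) = 0) ∧
      eVariationOn γ (Set.Icc 0 (a + b)) ≤
        eVariationOn α (Set.Icc 0 a) + eVariationOn β (Set.Icc 0 b) := by
  let γ : ℝ → X := fun t => if t ≤ a then α t else β (t - a)
  have h1 : ∀ t ∈ Set.Icc 0 a, γ t = α t := fun t ht => if_pos ht.2
  have h2 : ∀ t ∈ Set.Icc 0 b, edist (γ (a + t)) (β t) = 0 := by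
    intro t ht
    rcases ht.1.eq_or_lt with rfl | h0
    · simpa [γ] using h
    · simp [γ, not_le.2 h0]
  have hle : ∀ s ∈ Set.Icc 0 (a + b), ∀ t ∈ Set.Icc 0 (a + b), s ≤ t →
      edist (γ s) (γ t) ≤ edist s t := by
    intro s hs t ht hst
    by_cases hta : t ≤ a
    · rw [h1 s ⟨hs.1, hst.trans hta⟩, h1 t ⟨ht.1, hta⟩]
      simpa using hα ⟨hs.1, hst.trans hta⟩ ⟨ht.1, hta⟩
    push Not at hta
    have ht' : t - a ∈ Set.Icc 0 b := ⟨by linarith, by linarith [ht.2]⟩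
    have hγt : γ t = β (t - a) := if_neg (not_le.2 hta)
    by_cases hsa : s ≤ a
    · rw [h1 s ⟨hs.1, hsa⟩, hγt]
      have i1 : edist (α s) (α a) ≤ edist s a := by
        simpa using hα ⟨hs.1, hsa⟩ ⟨ha, le_rfl⟩
      have i2 : edist (β 0) (β (t - a)) ≤ edist 0 (t - a) := by
        simpa using hβ ⟨le_rfl, hb⟩ ht'
      refine (edist_triangle4 _ (α a) (β 0) _).trans ?_
      rw [h, add_zero]
      refine (add_le_add i1 i2).trans ?_
      simp only [edist_dist, Real.dist_eq]
      rw [← ENNReal.ofReal_add (abs_nonneg _) (abs_nonneg _)]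
      refine ENNReal.ofReal_le_ofReal ?_
      rw [abs_of_nonpos (by linarith), abs_of_nonpos (by linarith), abs_of_nonpos (by linarith)]
      linarith
    · push Not at hsa
      rw [hγt, show γ s = β (s - a) from if_neg (not_le.2 hsa)]
      have := hβ (x := s - a) ⟨by linarith, by linarith [hs.2]⟩ ht'
      simpa using this
  refine ⟨γ, fun s hs t ht => ?_, h1, h2, ?_⟩
  · rw [ENNReal.coe_one, one_mul]
    rcases le_total s t with hst | hst
    · exact hle s hs t ht hst
    · rw [edist_comm, edist_comm s]
      exact hle t ht s hs hst
  · have hadd := eVariationOn.Icc_add_Icc γ (s := Set.univ) ha (show a ≤ a + b by linarith)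
      (Set.mem_univ a)
    simp only [Set.univ_inter] at hadd
    rw [← hadd]
    refine add_le_add (eVariationOn.congr h1).le ?_
    have h3 : eVariationOn γ (Set.Icc a (a + b)) =
        eVariationOn (fun t => β (t - a)) (Set.Icc a (a + b)) := by
      refine eVariationOn.eq_of_edist_zero_on fun t ht => ?_
      simpa using h2 (t - a) ⟨by linarith [ht.1], by linarith [ht.2]⟩
    rw [h3]
    refine eVariationOn.comp_le_of_monotoneOn β (fun t => t - a) ?_ ?_
    · exact fun s _ t _ hst => sub_le_sub_right hst a
    · exact fun t ht => ⟨by linarith [ht.1], by linarith [ht.2]⟩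

variable [DecidableEq E]

/-- The edges of a trail can be covered by a path in the contracted space whose length is at most
the uncovered length of the trail. -/
theorem WGraph.Trail.exists_path (hd : ∀ v, 0 ≤ d v)
    (hC : ∀ z x, edist z (Point.vertex x) ≤ ENNReal.ofReal (d x) → z ∈ C)
    (hw : ∀ e, 0 ≤ G.weight e) {u v : V} {N : Finset E} (p : G.Trail u v N) :
    ∃ (T : ℝ) (γ : ℝ → Contracted C), 0 ≤ T ∧ LipschitzOnWith 1 γ (Set.Icc 0 T) ∧
      edist (γ 0) (toContracted C (Point.vertex u)) = 0 ∧ Covers γ T N ∧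
      eVariationOn γ (Set.Icc 0 T) ≤
        ENNReal.ofReal (∑ e ∈ N, (G.weight e - G.coveredLength d e)) := by
  induction p with
  | nil u =>
    refine ⟨0, fun _ => toContracted C (Point.vertex u), le_rfl, ?_, edist_self _, ?_, ?_⟩
    · exact (LipschitzWith.const' _).lipschitzOnWith
    · simp [Covers]
    · rw [eVariationOn.subsingleton _ (by simp)]
      exact zero_le
  | @cons u v w e N h he p ih =>
    obtain ⟨T, β, hT, hβ, hβ0, hcβ, hvβ⟩ := ih
    obtain ⟨α, hα, hα0, hα1, hcα, hvα⟩ := exists_path_of_joins hd hC (hw e) h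
    have hαβ : edist (α (G.weight e)) (β 0) = 0 := by
      refine le_antisymm ((edist_triangle _ (toContracted C (Point.vertex v)) _).trans ?_)
        (zero_le)
      rw [hα1, edist_comm, hβ0, add_zero]
    obtain ⟨γ, hγ, hγ1, hγ2, hvγ⟩ := exists_concat (hw e) hT hα.lipschitzOnWith hβ hαβ
    refine ⟨G.weight e + T, γ, add_nonneg (hw e) hT, hγ, ?_, ?_, ?_⟩
    · rw [hγ1 0 ⟨le_rfl, hw e⟩, hα0]
    · intro f hf t
      rcases Finset.mem_insert.1 hf with rfl | hf
      · obtain ⟨s, hs, hst⟩ := hcα f (Finset.mem_singleton_self _) t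
        exact ⟨s, ⟨hs.1, by linarith [hs.2]⟩, by rw [hγ1 s hs, hst]⟩
      · obtain ⟨s, hs, hst⟩ := hcβ f hf t
        refine ⟨G.weight e + s, ⟨add_nonneg (hw e) hs.1, by linarith [hs.2]⟩, ?_⟩
        refine le_antisymm ((edist_triangle _ (β s) _).trans ?_) (zero_le)
        rw [hγ2 s hs, hst, add_zero]
    · have hc : ∀ f, 0 ≤ G.weight f - G.coveredLength d f := fun f =>
        sub_nonneg.2 (min_le_left _ _)
      rw [Finset.sum_insert he, ENNReal.ofReal_add (hc e) (Finset.sum_nonneg fun f _ => hc f)]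
      exact hvγ.trans (add_le_add hvα hvβ)

/-- A logical operator that is a trail bounds the soft output by its uncovered length. -/
theorem softOutput_le_of_trail (hd : ∀ v, 0 ≤ d v)
    (hC : ∀ z x, edist z (Point.vertex x) ≤ ENNReal.ofReal (d x) → z ∈ C)
    (hw : ∀ e, 0 ≤ G.weight e) {u v : V} {N : Finset E} (p : G.Trail u v N)
    {logical : Finset E → Prop} (hN : logical N) :
    softOutput logical C ≤ ENNReal.ofReal (∑ e ∈ N, (G.weight e - G.coveredLength d e)) := by
  obtain ⟨T, γ, hT, hγ, -, hcov, hvar⟩ := p.exists_path hd hC hw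
  exact iInf_le_of_le T <| iInf_le_of_le hT <| iInf_le_of_le γ <|
    iInf_le_of_le hγ.continuousOn <| iInf_le_of_le ⟨N, hN, hcov⟩ hvar

end Paths

/-! ### Likelihoods of errors -/

section Likelihood

variable {n : ℕ} {p : ℝ}

theorem errorVec_mem_of_sdiff_mem {A : Submodule (ZMod 2) (Fin n → ZMod 2)}
    {L Q : Finset (Fin n)} (hQ : Q ⊆ L) (h1 : errorVec Q ∈ A) (h2 : errorVec (L \ Q) ∈ A) :
    errorVec L ∈ A := by
  have : errorVec L = errorVec (L \ Q) + errorVec Q := by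
    funext i
    by_cases h3 : i ∈ Q
    · simp [errorVec, h3, hQ h3]
    · simp [errorVec, h3]
  rw [this]
  exact A.add_mem h2 h1

theorem logWeight_pos (hp0 : 0 < p) (hp1 : p < 1 / 2) : 0 < logWeight p :=
  Real.log_pos ((one_lt_div hp0).2 (by linarith))

instance isFiniteMeasure_bitFlip : MeasureTheory.IsFiniteMeasure (bitFlip n p) := by
  have h0 := MeasureTheory.Measure.smul_finite (MeasureTheory.Measure.dirac (0 : ZMod 2))
    (ENNReal.ofReal_ne_top (r := 1 - p))
  have h1 := MeasureTheory.Measure.smul_finite (MeasureTheory.Measure.dirac (1 : ZMod 2))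
    (ENNReal.ofReal_ne_top (r := p))
  unfold bitFlip
  infer_instance

theorem bitFlip_real_singleton (hp0 : 0 < p) (hp1 : p < 1 / 2) (N : Finset (Fin n)) :
    (bitFlip n p).real {errorVec N} = ∏ i, if i ∈ N then p else 1 - p := by
  have h0 := MeasureTheory.Measure.smul_finite (MeasureTheory.Measure.dirac (0 : ZMod 2))
    (ENNReal.ofReal_ne_top (r := 1 - p))
  have h1 := MeasureTheory.Measure.smul_finite (MeasureTheory.Measure.dirac (1 : ZMod 2))
    (ENNReal.ofReal_ne_top (r := p))
  rw [MeasureTheory.Measure.real, bitFlip, MeasureTheory.Measure.pi_singleton, ENNReal.toReal_prod]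
  refine Finset.prod_congr rfl fun i _ => ?_
  by_cases hi : i ∈ N
  · simp [errorVec, hi, hp0.le]
  · simp [errorVec, hi, (by linarith : p ≤ 1)]

theorem bitFlip_real_singleton_pos (hp0 : 0 < p) (hp1 : p < 1 / 2) (N : Finset (Fin n)) :
    0 < (bitFlip n p).real {errorVec N} := by
  rw [bitFlip_real_singleton hp0 hp1]
  refine Finset.prod_pos fun i _ => ?_
  split_ifs <;> linarith

theorem log_bitFlip_real_singleton (hp0 : 0 < p) (hp1 : p < 1 / 2) (N : Finset (Fin n)) :
    Real.log ((bitFlip n p).real {errorVec N}) = n * Real.log (1 - p) - N.card * logWeight p := by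
  rw [bitFlip_real_singleton hp0 hp1, Real.log_prod]
  · have h1 : ∀ i, Real.log (if i ∈ N then p else 1 - p) =
        Real.log (1 - p) - if i ∈ N then logWeight p else 0 := by
      intro i
      split_ifs
      · rw [logWeight, Real.log_div (by linarith) hp0.ne']; ring
      · ring
    simp [h1]
  · intro i _
    split_ifs <;> linarith

end Likelihood

namespace SurfaceCode

variable {r s n : ℕ} (code : SurfaceCode r s n)

theorem log_condProb_div {p : ℝ} (hp0 : 0 < p) (hp1 : p < 1 / 2) {σ : Fin r → ZMod 2}
    {F M : Finset (Fin n)} (hF : code.HZ.mulVec (errorVec F) = σ)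
    (hM : code.HZ.mulVec (errorVec M) = σ) :
    Real.log (code.condProb p σ F / code.condProb p σ M) =
      (code.decodingGraph p).edgeWeight M - (code.decodingGraph p).edgeWeight F := by
  have hcond : ∀ N : Finset (Fin n), code.HZ.mulVec (errorVec N) = σ → code.condProb p σ N =
      ((bitFlip n p).real {x | code.HZ.mulVec x = σ})⁻¹ * (bitFlip n p).real {errorVec N} := by
    intro N hN
    have hsub : {x | code.HZ.mulVec x = σ} ∩ {errorVec N} = {errorVec N} :=
      Set.inter_eq_right.2 (Set.singleton_subset_iff.2 hN)
    rw [condProb, MeasureTheory.Measure.real, ProbabilityTheory.cond_apply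
      (Set.toFinite _).measurableSet, hsub, ENNReal.toReal_mul, ENNReal.toReal_inv]
    rfl
  have hpos : 0 < (bitFlip n p).real {x | code.HZ.mulVec x = σ} :=
    (bitFlip_real_singleton_pos hp0 hp1 F).trans_le
      (MeasureTheory.measureReal_mono (Set.singleton_subset_iff.2 hF))
  rw [hcond F hF, hcond M hM, mul_div_mul_left _ _ (inv_ne_zero hpos.ne'),
    Real.log_div (bitFlip_real_singleton_pos hp0 hp1 F).ne'
      (bitFlip_real_singleton_pos hp0 hp1 M).ne',
    log_bitFlip_real_singleton hp0 hp1, log_bitFlip_real_singleton hp0 hp1]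
  simp only [WGraph.edgeWeight, decodingGraph, Finset.sum_const, nsmul_eq_mul]
  ring

/-! ### The decoding graph -/

/-- Since a column of `HZ` has at most two nonzero entries, it is the boundary of the edge of the
decoding graph, restricted to the checks. -/
theorem HZ_apply (p : ℝ) (j : Fin r) (i : Fin n) :
    code.HZ j i = (Pi.single ((code.decodingGraph p).src i) 1 +
      Pi.single ((code.decodingGraph p).tgt i) 1 : WithTop (Fin r) → ZMod 2) j := by
  have hS : ∀ S : Finset (Fin r), S.card ≤ 2 → (if j ∈ S then 1 else 0 : ZMod 2) =
      (Pi.single S.min 1 + Pi.single (S.filter fun j : Fin r => S.min < (j : WithTop (Fin r))).min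
        1 : WithTop (Fin r) → ZMod 2) j := by
    intro S hS
    have hpair : ∀ a b : Fin r, a < b → (if j ∈ ({a, b} : Finset (Fin r)) then 1 else 0 : ZMod 2) =
        (Pi.single ({a, b} : Finset (Fin r)).min 1 + Pi.single (({a, b} : Finset (Fin r)).filter
          fun j : Fin r => ({a, b} : Finset (Fin r)).min < (j : WithTop (Fin r))).min
          1 : WithTop (Fin r) → ZMod 2) j := by
      intro a b hab
      have h1 : ({a, b} : Finset (Fin r)).min = a := by
        rw [Finset.min_insert, Finset.min_singleton]
        exact min_eq_left (WithTop.coe_le_coe.2 hab.le)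
      have h2 : (({a, b} : Finset (Fin r)).filter fun j : Fin r =>
          (a : WithTop (Fin r)) < (j : WithTop (Fin r))) = {b} := by
        ext x
        simp only [Finset.mem_filter, Finset.mem_insert, Finset.mem_singleton, WithTop.coe_lt_coe]
        constructor
        · rintro ⟨rfl | rfl, h⟩
          · exact absurd h (lt_irrefl _)
          · rfl
        · rintro rfl
          exact ⟨Or.inr rfl, hab⟩
      rw [h1, h2, Finset.min_singleton]
      simp only [Pi.add_apply, Pi.single_apply, WithTop.coe_eq_coe, Finset.mem_insert,
        Finset.mem_singleton]
      by_cases hja : j = a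
      · subst hja
        simp [hab.ne]
      · simp [hja]
    obtain h | h | h : S.card = 0 ∨ S.card = 1 ∨ S.card = 2 := by omega
    · obtain rfl := Finset.card_eq_zero.1 h
      simp
    · obtain ⟨a, rfl⟩ := Finset.card_eq_one.1 h
      simp [Finset.filter_singleton, Pi.single_apply]
    · obtain ⟨a, b, hab, rfl⟩ := Finset.card_eq_two.1 h
      rcases lt_or_gt_of_ne hab with h | h
      · exact hpair a b h
      · rw [Finset.pair_comm]
        exact hpair b a h
  have h1 : code.HZ j i = if j ∈ code.checks i then 1 else 0 := by
    simp only [checks, Finset.mem_filter, Finset.mem_univ, true_and]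
    generalize code.HZ j i = a
    revert a; decide
  rw [h1]
  exact hS (code.checks i) (code.colWeight_le i)

theorem mulVec_errorVec (p : ℝ) (N : Finset (Fin n)) (j : Fin r) :
    code.HZ.mulVec (errorVec N) j = (code.decodingGraph p).boundary N j := by
  simp only [Matrix.mulVec, dotProduct, errorVec, mul_ite, mul_one, mul_zero,
    Finset.sum_ite_mem, Finset.univ_inter, WGraph.boundary, Finset.sum_apply]
  exact Finset.sum_congr rfl fun i _ => code.HZ_apply p j i

theorem coe_mem_syndromeVertices (σ : Fin r → ZMod 2) (j : Fin r) :
    (j : WithTop (Fin r)) ∈ syndromeVertices σ ↔ σ j ≠ 0 := by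
  unfold syndromeVertices
  dsimp only
  split_ifs <;> simp

theorem IsValid.mulVec_errorVec {code : SurfaceCode r s n} {p : ℝ} {σ : Fin r → ZMod 2}
    {N : Finset (Fin n)} (h : code.IsValid p σ N) : code.HZ.mulVec (errorVec N) = σ := by
  funext j
  rw [code.mulVec_errorVec p, (WGraph.isValid_iff _).1 h]
  simp only [coe_mem_syndromeVertices]
  generalize σ j = a
  revert a; decide

/-- A logical operator without boundary, also at the boundary vertex, contains a closed trail that
is a logical operator: otherwise all closed trails in a decomposition would be stabilizers. -/
theorem exists_logical_trail (p : ℝ) {L : Finset (Fin n)}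
    (hb : (code.decodingGraph p).boundary L = 0)
    (hL : errorVec L ∉ Submodule.span (ZMod 2) (Set.range fun k => code.HX k)) :
    ∃ v Q, Q ⊆ L ∧ (code.decodingGraph p).Trail v v Q ∧ code.IsLogical Q := by
  induction hk : L.card using Nat.strong_induction_on generalizing L with
  | _ k ih =>
    have hne : L.Nonempty := by
      rw [Finset.nonempty_iff_ne_empty]
      rintro rfl
      apply hL
      convert Submodule.zero_mem _
      funext i
      simp [errorVec]
    obtain ⟨v, Q, hQne, hQ, q⟩ := WGraph.exists_closed_trail hne hb
    have hbQ : (code.decodingGraph p).boundary Q = 0 := by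
      rw [q.boundary_eq, WGraph.pi_add_self]
    by_cases hs : errorVec Q ∈ Submodule.span (ZMod 2) (Set.range fun k => code.HX k)
    · have hlt : (L \ Q).card < k := hk ▸ Finset.card_lt_card (Finset.sdiff_ssubset hQ hQne)
      obtain ⟨x, R, hR, hq, hlog⟩ := ih _ hlt
        (by rw [WGraph.boundary_sdiff _ hQ, hb, hbQ, add_zero])
        (fun h => hL (errorVec_mem_of_sdiff_mem hQ hs h)) rfl
      exact ⟨x, R, hR.trans Finset.sdiff_subset, hq, hlog⟩
    · refine ⟨v, Q, hQ, q, ?_, hs⟩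
      funext j
      rw [code.mulVec_errorVec p, hbQ]
      rfl

end SurfaceCode

end SoftOutput

theorem mainTheorem2 {r s n : ℕ} (code : SoftOutput.SurfaceCode r s n)
    (p : ℝ) (hp0 : 0 < p) (hp1 : p < 1 / 2) (σ : Fin r → ZMod 2)
    (F M : Finset (Fin n)) (hF : code.IsMWPMCorrection p σ F) (hM : code.IsMinOpposite p σ F M)
    (y : Finset (WithTop (Fin r)) → NNReal)
    (hy : SoftOutput.IsDualOptimal (code.decodingGraph p)
      (SoftOutput.SurfaceCode.syndromeVertices σ) y) :
    (Real.log (code.condProb p σ F / code.condProb p σ M)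
        = (code.decodingGraph p).edgeWeight M - (code.decodingGraph p).edgeWeight F ∧
      code.phi p σ y ≠ ⊤ ∧
      (code.phi p σ y).toReal ≤ Real.log (code.condProb p σ F / code.condProb p σ M)) ∧
    (code.decodingGraph p).edgeWeight F
      ≤ SoftOutput.dualObjective (SoftOutput.SurfaceCode.syndromeVertices σ) y ∧
    ∀ N : Finset (Fin n), code.IsValid p σ N →
      (SoftOutput.dualObjective (SoftOutput.SurfaceCode.syndromeVertices σ) y : ℝ)
        ≤ SoftOutput.weightInside N (code.clusters p σ y) := by
  set G := code.decodingGraph p with hG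
  set T := SoftOutput.SurfaceCode.syndromeVertices σ with hT
  have hω : 0 < SoftOutput.logWeight p := SoftOutput.logWeight_pos hp0 hp1
  have hw : ∀ e, 0 ≤ G.weight e := fun _ => hω.le
  have hdual : G.edgeWeight F ≤ SoftOutput.dualObjective T y := by
    obtain ⟨y', hy', hval⟩ := SoftOutput.WGraph.exists_dual_eq_edgeWeight (G := G)
      (w := ⟨_, hω.le⟩) hω (fun _ => rfl) hF.1 hF.2
    rw [← hval]
    exact NNReal.coe_le_coe.2 (hy.2 y' hy')
  obtain ⟨d, hr, hlip, hball⟩ := G.exists_depth hw (SoftOutput.dualRadius T y)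
  have hd : ∀ v, 0 ≤ d v := fun v => (NNReal.coe_nonneg _).trans (hr v)
  have hC : ∀ z x, edist z (SoftOutput.Point.vertex x) ≤ ENNReal.ofReal (d x) →
      z ∈ code.clusters p σ y :=
    fun z x hz => SoftOutput.mem_clusterSet_of_edist_le hw hball hz
  have hcov : ∀ N, code.IsValid p σ N →
      (SoftOutput.dualObjective T y : ℝ) ≤ ∑ e ∈ N, G.coveredLength d e :=
    fun N hN => SoftOutput.WGraph.dualObjective_le_sum_coveredLength hy.1 hw hr hlip hN
  have hlog := code.log_condProb_div hp0 hp1 hF.1.mulVec_errorVec hM.1.1.mulVec_errorVec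
  have hbL : G.boundary (symmDiff M F) = 0 := by
    rw [SoftOutput.WGraph.boundary_symmDiff]
    funext v
    rw [Pi.add_apply, (SoftOutput.WGraph.isValid_iff _).1 hM.1.1,
      (SoftOutput.WGraph.isValid_iff _).1 hF.1, CharTwo.add_self_eq_zero, Pi.zero_apply]
  obtain ⟨v, Q, hQ, q, hlogical⟩ := code.exists_logical_trail p hbL hM.1.2.2
  have hphi : code.phi p σ y ≤ ENNReal.ofReal (G.edgeWeight M - G.edgeWeight F) := by
    refine (SoftOutput.softOutput_le_of_trail hd hC hw q hlogical).trans
      (ENNReal.ofReal_le_ofReal ?_)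
    have hc : ∀ e, 0 ≤ G.weight e - G.coveredLength d e := fun e => sub_nonneg.2 (min_le_left _ _)
    -- By both dualities the covered lengths of `M` and `F` are at least `|F|`; so `F` has no
    -- uncovered part, and the uncovered part of `M` is at most `|M| - |F|`.
    calc ∑ e ∈ Q, (G.weight e - G.coveredLength d e)
        ≤ ∑ e ∈ M ∪ F, (G.weight e - G.coveredLength d e) :=
          Finset.sum_le_sum_of_subset_of_nonneg
            (hQ.trans symmDiff_le_sup) fun e _ _ => hc e
      _ ≤ ∑ e ∈ M, (G.weight e - G.coveredLength d e) +
            ∑ e ∈ F, (G.weight e - G.coveredLength d e) := by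
          rw [← Finset.sum_union_inter]
          exact le_add_of_nonneg_right (Finset.sum_nonneg fun e _ => hc e)
      _ ≤ G.edgeWeight M - G.edgeWeight F := by
          rw [Finset.sum_sub_distrib, Finset.sum_sub_distrib]
          have h1 := hcov M hM.1.1
          have h2 := hcov F hF.1
          simp only [SoftOutput.WGraph.edgeWeight] at hdual ⊢
          linarith
  have hgap : 0 ≤ G.edgeWeight M - G.edgeWeight F := sub_nonneg.2 (hF.2 M hM.1.1)
  refine ⟨⟨hlog, ne_top_of_le_ne_top ENNReal.ofReal_ne_top hphi, ?_⟩, hdual, fun N hN => ?_⟩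
  · rw [hlog]
    exact ENNReal.toReal_le_of_le_ofReal hgap hphi
  · exact (hcov N hN).trans (Finset.sum_le_sum fun e _ =>
      SoftOutput.coveredLength_le_volume hd hC e (hw e))
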